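/- Let $(X,d)$ be a complete separable metric space with a non-negative Borel measure $\mathfrak m$ that is finite on bounded Borel sets, and let $q\in(1,\infty]$. The space $C([0,1];X)$ carries the uniform topology and its Borel $\sigma$-algebra; $\mathcal L_1$ is Lebesgue measure on $[0,1]$; $e(\gamma,t)=e_t(\gamma)=\gamma_t$. For $\gamma\in C([0,1];X)$ let $\ell(\gamma)\in[0,\infty]$ be its length; if $\ell(\gamma)<\infty$ ($\gamma$ is rectifiable), let $s_\gamma$ be the measure on $[0,1]$ with $s_\gamma([a,b])=\ell(\gamma|_{[a,b]})$. For $r\in[1,\infty]$, $AC^r([0,1];X)$ is the set of curves $\gamma$ for which there is $0\le g\in L^r(0,1)$ with $d(\gamma_s,\gamma_t)\le\int_s^t g\,dr$ for all $0\le s<t\le1$; $AC=AC^1$, and $|\dot\gamma_t|=\lim_{h\to0}d(\gamma_{t+h},\gamma_t)/|h|$ is the metric speed. The $q$-energy is $E_q(\gamma)=\int_0^1|\dot\gamma_t|^q\,dt$ if $q<\infty$ and $E_\infty(\gamma)=\operatorname{ess\,sup}_t|\dot\gamma_t|$, for $\gamma\in AC^q([0,1];X)$, and $E_q(\gamma)=\infty$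 otherwise. A plan is a finite Borel measure on $C([0,1];X)$ concentrated on rectifiable curves. A plan $\pi$ has - $1$-barycenter in $L^q(\mathfrak m)$ if $(e_0)_\#\pi+(e_1)_\#\pi+\int\gamma_\#s_\gamma\,d\pi(\gamma)$ is absolutely continuous with respect to $\mathfrak m$ with density in $L^q(\mathfrak m)$; - parametric $1$-barycenter in $L^\infty(\mathfrak m)$ if $(e_0)_\#\pi+(e_1)_\#\pi+e_\#(\pi\otimes\mathcal L_1)$ is absolutely continuous with respect to $\mathfrak m$ with density in $L^\infty(\mathfrak m)$; - finite $q$-energy if it is concentrated on $AC^q([0,1];X)$ and $\int E_q(\gamma)\,d\pi(\gamma)<\infty$. A curve $\eta$ is a reparametrization of $\gamma$ if $\gamma=\eta\circ R$ for some non-decreasing, continuous, surjective $R\colon[0,1]\to[0,1]$. **Theorem.** Let $\pi$ be a plan that is a probability measure and has $1$-barycenter in $L^q(\mathfrak m)$. Suppose that $\pi$ is concentrated on a Souslin set $\Gamma\subseteq C([0,1];X)$ of Lipschitz curves and that a) there is $C>0$ with $\mathrm{Lip}(\gamma)\le C$ for $\pi$-a.e. $\gamma\in\Gamma$; b) there is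 $\ell>0$ with $\ell(\gamma)\ge\ell$ for $\pi$-a.e. $\gamma\in\Gamma$; c) there is a bounded Borel set $B\subseteq X$ with $\gamma([0,1])\subseteq B$ for $\pi$-a.e. $\gamma\in\Gamma$. Then there exist a Borel map $H\colon AC([0,1];X)\to AC([0,1];X)$ such that $H(\gamma)$ is a reparametrization of $\gamma$ for every $\gamma$, and a plan $\sigma$ that is a probability measure, such that $\sigma$ has parametric $1$-barycenter in $L^\infty(\mathfrak m)$ and finite $q$-energy, the set $H(\Gamma)$ is Souslin in $C([0,1];X)$, and $\sigma$ is concentrated on $H(\Gamma)$. -/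

import Mathlib

open Set Filter Topology MeasureTheory
open scoped ENNReal NNReal

noncomputable section

namespace CurvePlan

variable {X : Type*} [MetricSpace X]

/-- The space `C([0,1]; X)`, with the topology of uniform convergence, carries its Borel
σ-algebra. -/
instance instMeasurableSpaceCurve : MeasurableSpace C(unitInterval, X) := borel _

instance instBorelSpaceCurve : BorelSpace C(unitInterval, X) := ⟨rfl⟩

/-- A measure is concentrated on `E` if the complement of `E` is negligible. (The value on `Eᶜ` is
the outer measure, so that for Souslin `E` this refers to the completion of `μ`.) -/
def ConcentratedOn {α : Type*} [MeasurableSpace α] (μ : Measure α) (E : Set α) : Prop :=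
  μ Eᶜ = 0

/-! ### Curves -/

/-- The length of a curve: the supremum of its variations over all partitions of `[0,1]`. -/
def length (γ : C(unitInterval, X)) : ℝ≥0∞ := eVariationOn γ univ

/-- The set `R([0,1]; X)` of rectifiable curves. -/
def rectifiableCurves (X : Type*) [MetricSpace X] : Set C(unitInterval, X) :=
  {γ | length γ < ∞}

/-- The set `LIP([0,1]; X)` of Lipschitz curves. -/
def lipschitzCurves (X : Type*) [MetricSpace X] : Set C(unitInterval, X) :=
  {γ | ∃ K : ℝ≥0, LipschitzWith K γ}

/-- The set `AC^q([0,1]; X)` of `q`-absolutely continuous curves, `q ∈ [1,∞]`. -/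
def acCurves (X : Type*) [MetricSpace X] (q : ℝ≥0∞) : Set C(unitInterval, X) :=
  {γ | ∃ g : unitInterval → ℝ, (∀ r, 0 ≤ g r) ∧ MemLp g q volume ∧
    ∀ s t : unitInterval, s < t → dist (γ s) (γ t) ≤ ∫ r in Icc s t, g r}

open scoped Classical in
/-- The metric speed `|γ̇_t| = lim_{s → t} d(γ_s, γ_t) / |s - t|`, with value `∞` if the limit does
not exist. -/
def metricSpeed (γ : C(unitInterval, X)) (t : unitInterval) : ℝ≥0∞ :=
  if h : ∃ v : ℝ≥0∞, Tendsto (fun s => edist (γ s) (γ t) / edist s t) (𝓝[≠] t) (𝓝 v)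
  then h.choose else ∞

open scoped Classical in
/-- The `q`-energy of a curve: `∫₀¹ |γ̇_t|^q dt` if `q < ∞` and `ess sup |γ̇_t|` if `q = ∞`,
for `γ ∈ AC^q`; it is `∞` for all other curves. -/
def curveEnergy (q : ℝ≥0∞) (γ : C(unitInterval, X)) : ℝ≥0∞ :=
  if γ ∈ acCurves X q then
    if q = ∞ then essSup (metricSpeed γ) volume
    else ∫⁻ t, metricSpeed γ t ^ q.toReal
  else ∞

/-- `η` is a reparametrization of `γ`: one has `γ = η ∘ R` for a non-decreasing, continuous and
surjective `R : [0,1] → [0,1]`. -/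
def IsReparametrization (γ η : C(unitInterval, X)) : Prop :=
  ∃ R : unitInterval → unitInterval, Monotone R ∧ Continuous R ∧ Function.Surjective R ∧
    ∀ t, γ t = η (R t)

/-- The function `t ↦ ℓ(γ|_{[0,t]})` of a rectifiable curve, as a Stieltjes function. -/
def lengthFunction (γ : C(unitInterval, X)) (hγ : γ ∈ rectifiableCurves X) :
    StieltjesFunction unitInterval where
  toFun t := variationOnFromTo γ univ 0 t
  mono' := by
    have hb : BoundedVariationOn γ univ := ne_of_lt hγ
    exact monotoneOn_univ.1
      (variationOnFromTo.monotoneOn hb.locallyBoundedVariationOn (mem_univ _))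
  right_continuous' x := by
    have hb : BoundedVariationOn γ univ := ne_of_lt hγ
    exact hb.continuousWithinAt_variationOnFromTo_Ici γ.continuous.continuousWithinAt

open scoped Classical in
/-- The total variation measure `s_γ` on `[0,1]` of a rectifiable curve, the measure induced by
`t ↦ ℓ(γ|_{[0,t]})`. (The value for non-rectifiable curves is irrelevant.) -/
def lengthMeasure (γ : C(unitInterval, X)) : Measure unitInterval :=
  if hγ : γ ∈ rectifiableCurves X then (lengthFunction γ hγ).measure else 0

/-! ### Plans -/

/-- A plan on `X`: a finite Borel measure on `C([0,1]; X)`, concentrated on rectifiable curves. -/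
structure IsPlan (π : Measure C(unitInterval, X)) : Prop where
  finite : IsFiniteMeasure π
  concentrated : ConcentratedOn π (rectifiableCurves X)

/-- The plan is concentrated on `AC^q([0,1]; X)` and `∫ E_q(γ) dπ(γ) < ∞`. -/
def HasFiniteEnergy (q : ℝ≥0∞) (π : Measure C(unitInterval, X)) : Prop :=
  ConcentratedOn π (acCurves X q) ∧ ∫⁻ γ, curveEnergy q γ ∂π < ∞

variable [MeasurableSpace X]

/-- The measure `(e₀)_# π + (e₁)_# π + ∫ γ_# s_γ dπ(γ)` on `X`. -/
def barycenterMeasure (π : Measure C(unitInterval, X)) : Measure X :=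
  π.map (fun γ => γ 0) + π.map (fun γ => γ 1) + π.bind (fun γ => (lengthMeasure γ).map γ)

/-- The measure `(e₀)_# π + (e₁)_# π + e_# (π ⊗ 𝓛₁)` on `X`, where `e(γ, t) = γ_t` and `𝓛₁` is the
Lebesgue measure on `[0,1]`. -/
def parametricBarycenterMeasure (π : Measure C(unitInterval, X)) : Measure X :=
  π.map (fun γ => γ 0) + π.map (fun γ => γ 1) +
    (π.prod (volume : Measure unitInterval)).map (fun p => p.1 p.2)

/-- `μ ≪ m` with density `dμ/dm` in `L^q(m)`. -/
def HasDensityIn (μ m : Measure X) (q : ℝ≥0∞) : Prop :=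
  μ ≪ m ∧ MemLp (μ.rnDeriv m) q m

/-- The plan `π` admits a `1`-barycenter in `L^q(m)`. -/
def HasBarycenterIn (π : Measure C(unitInterval, X)) (m : Measure X) (q : ℝ≥0∞) : Prop :=
  HasDensityIn (barycenterMeasure π) m q

/-- The plan `π` admits a parametric `1`-barycenter in `L^q(m)`. -/
def HasParametricBarycenterIn (π : Measure C(unitInterval, X)) (m : Measure X) (q : ℝ≥0∞) :
    Prop :=
  HasDensityIn (parametricBarycenterMeasure π) m q

end CurvePlan

end

noncomputable section

namespace CurvePlan

/-! Let `μ` be the barycenter measure of `π`, `b` its density, and `ρ ≥ 1` a finite function with `b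
≤ ρ` a.e. For `q < ∞` take `ρ = max 1 b`; then `∫ ρ^(q-1) dμ ≤ ∫ (b + b^q) dm < ∞`. For `q = ∞` take
`ρ` constant (`HasDensityIn.exists_majorant`).

Put `c(γ) = ∫ 1/ρ(γ) ds_γ` and reparametrize `γ` so that time is distributed along it as `(c ρ)⁻¹
ds_γ`. The new curve `η = H(γ)` has speed at most `c ρ(η)`. The plan `σ` is the image under `H` of
`w π`, divided by `Z = ∫ w dπ`, where `w = min(c, 1/ρ(γ 0), 1/ρ(γ 1))`.

Barycenter: `w ∫ 1_A(η) dr = (w/c) ∫ (1_A/ρ)(γ) ds_γ ≤ ∫ (1_A/ρ)(γ) ds_γ`, and `w 1_A ≤ 1_A/ρ` at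
both endpoints. Integrating in `π` gives `∫_A 1/ρ dμ ≤ m(A)`, so the parametric barycenter is at
most `Z⁻¹ m` (`parametricBarycenterMeasure_slowedPlan_le`).

Energy: for `q < ∞`, `∫ (c ρ(η))^q dr = c^(q-1) ∫ ρ(γ)^(q-1) ds_γ`, with `c ≤ K` for a length bound
`K`. Averaging over `π` leaves a multiple of `∫ ρ^(q-1) dμ` (`hasFiniteEnergy_slowedPlan`). For `q =
∞` the speed is bounded. The Lipschitz bound supplies `K`; the lower length bound makes `c`, and
hence `Z`, positive.

Since `ρ` is only measurable, `H` is built as `γ` composed with the quantile function of its time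
measure (`quantileReparam`), which also makes it Borel. -/

/-! ### Measurability on the space of curves -/

theorem measurable_eval {X : Type*} [MetricSpace X] [TopologicalSpace.SeparableSpace X]
    [MeasurableSpace X] [BorelSpace X] :
    Measurable fun p : C(unitInterval, X) × unitInterval => p.1 p.2 := by
  have := UniformSpace.secondCountable_of_separable X
  exact continuous_eval.measurable

theorem measurable_eval_const {X : Type*} [MetricSpace X] [MeasurableSpace X] [BorelSpace X]
    (t : unitInterval) : Measurable fun γ : C(unitInterval, X) => γ t :=
  (continuous_eval_const t).measurable

/-- A map into a space of continuous functions is measurable as soon as all its evaluations are. -/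
theorem measurable_of_measurable_eval {X α : Type*} [MetricSpace X] [CompleteSpace X]
    [TopologicalSpace.SeparableSpace X] [MeasurableSpace X] [BorelSpace X] [MeasurableSpace α]
    {F : α → C(unitInterval, X)} (h : ∀ t, Measurable fun a => F a t) : Measurable F := by
  have := UniformSpace.secondCountable_of_separable X
  let ev : C(unitInterval, X) → ℕ → X := fun f n => f (TopologicalSpace.denseSeq unitInterval n)
  have hc : Continuous ev := continuous_pi fun n => by fun_prop
  have hi : Function.Injective ev := fun f g hfg => by
    apply DFunLike.coe_injective
    exact Continuous.ext_on (TopologicalSpace.denseRange_denseSeq unitInterval) f.continuous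
      g.continuous (by rintro _ ⟨n, rfl⟩; exact congrFun hfg n)
  have he : MeasurableEmbedding ev := hc.measurableEmbedding hi
  rw [← he.measurable_comp_iff]
  exact measurable_pi_lambda _ fun n => h _

/-- The image of a set of full measure has full measure for the push-forward measure. -/
theorem map_compl_image_eq_zero {α β : Type*} [TopologicalSpace α] [PolishSpace α]
    [MeasurableSpace α] [BorelSpace α] [TopologicalSpace β] [PolishSpace β]
    [MeasurableSpace β] [BorelSpace β] {μ : Measure α} [IsFiniteMeasure μ] {f : α → β}
    (hf : Measurable f) {E : Set α} (hE : μ Eᶜ = 0) : μ.map f (f '' E)ᶜ = 0 := by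
  obtain ⟨N, hN, hNm, hN0⟩ := exists_measurable_superset_of_null hE
  let g : α → α × β := fun a => (a, f a)
  have hg : Measurable g := measurable_id.prodMk hf
  -- The image of `E` need not be Borel, but the graph of `f` over the Borel set `Nᶜ ⊆ E` is.
  -- Compact subsets exhaust its mass, and their projections are Borel subsets of `f '' E`.
  let D : Set (α × β) := {p | f p.1 = p.2} ∩ Prod.fst ⁻¹' Nᶜ
  have hD : MeasurableSet D :=
    (measurableSet_eq_fun (hf.comp measurable_fst) measurable_snd).inter (measurable_fst hNm.compl)
  have hD0 : μ.map g Dᶜ = 0 := by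
    rw [Measure.map_apply hg hD.compl]
    refine measure_mono_null (fun a ha => ?_) hN0
    by_contra h
    exact ha ⟨rfl, h⟩
  have hfin : IsFiniteMeasure (μ.map g) := inferInstance
  have key : ∀ n : ℕ, ∃ K ⊆ D, IsCompact K ∧ (μ.map g) (D \ K) < (n + 1 : ℝ≥0∞)⁻¹ := fun n =>
    hD.exists_isCompact_sdiff_lt (measure_ne_top _ _) (by simp)
  choose K hKD hKc hKμ using key
  have hKm : MeasurableSet (⋃ n, Prod.snd '' K n) :=
    .iUnion fun n => ((hKc n).image continuous_snd).measurableSet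
  refine measure_mono_null (t := (⋃ n, Prod.snd '' K n)ᶜ) ?_ ?_
  · refine compl_subset_compl.2 (iUnion_subset fun n => ?_)
    rintro _ ⟨p, hp, rfl⟩
    obtain ⟨h1, h2⟩ := hKD n hp
    exact ⟨p.1, by_contra fun h => h2 (hN h), h1⟩
  · have h0 : μ.map g (⋃ n, K n)ᶜ = 0 := by
      refine measure_mono_null (t := Dᶜ ∪ (D \ ⋃ n, K n)) (fun p hp => ?_) ?_
      · by_cases h : p ∈ D
        · exact Or.inr ⟨h, hp⟩
        · exact Or.inl h
      · refine measure_union_null hD0 ?_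
        refine le_antisymm (ENNReal.le_of_forall_pos_le_add fun ε hε _ => ?_) zero_le
        obtain ⟨n, hn⟩ := ENNReal.exists_inv_nat_lt (a := (ε : ℝ≥0∞)) (by simpa using hε.ne')
        rw [zero_add]
        calc _ ≤ μ.map g (D \ K n) := measure_mono (sdiff_subset_sdiff_right (subset_iUnion _ n))
          _ ≤ (n + 1 : ℝ≥0∞)⁻¹ := (hKμ n).le
          _ ≤ (n : ℝ≥0∞)⁻¹ := ENNReal.inv_le_inv.2 le_self_add
          _ ≤ ε := hn.le
    rw [Measure.map_apply hf hKm.compl]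
    rw [Measure.map_apply hg (MeasurableSet.iUnion fun n => (hKc n).measurableSet).compl] at h0
    refine measure_mono_null (fun a ha => ?_) h0
    intro hmem
    obtain ⟨n, hn⟩ := mem_iUnion.1 hmem
    exact ha (mem_iUnion.2 ⟨n, _, hn, rfl⟩)

/-! ### Metric derivative and energy -/

theorem absolutelyContinuousOnInterval_of_dist_le {X Y : Type*} [PseudoMetricSpace X]
    [PseudoMetricSpace Y] {f : ℝ → X} {F : ℝ → Y} {a b : ℝ}
    (hF : AbsolutelyContinuousOnInterval F a b)
    (h : ∀ s ∈ uIcc a b, ∀ t ∈ uIcc a b, dist (f s) (f t) ≤ dist (F s) (F t)) :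
    AbsolutelyContinuousOnInterval f a b := by
  unfold AbsolutelyContinuousOnInterval at hF ⊢
  refine tendsto_of_tendsto_of_tendsto_of_le_of_le' tendsto_const_nhds hF
    (Eventually.of_forall fun E => Finset.sum_nonneg fun _ _ => dist_nonneg) ?_
  filter_upwards [mem_inf_of_right (mem_principal_self _)] with E hE
  exact Finset.sum_le_sum fun i hi => h _ (hE.1 i hi).1 _ (hE.1 i hi).2

/-- The metric derivative of an absolutely continuous curve exists almost everywhere, and is the
least density that controls the increments of the curve. -/
theorem ae_exists_tendsto_metricDerivative {X : Type*} [MetricSpace X]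
    [TopologicalSpace.SeparableSpace X] {f : ℝ → X} {g : ℝ → ℝ} {a b : ℝ} (hab : a ≤ b)
    (hg : IntervalIntegrable g volume a b)
    (h : ∀ s ∈ Icc a b, ∀ t ∈ Icc a b, s ≤ t → dist (f s) (f t) ≤ ∫ r in s..t, g r) :
    ∀ᵐ t, t ∈ Ioo a b → ∃ v, 0 ≤ v ∧ v ≤ g t ∧
      Tendsto (fun s => dist (f s) (f t) / |s - t|) (𝓝[≠] t) (𝓝 v) := by
  have : Nonempty X := ⟨f 0⟩
  let x := TopologicalSpace.denseSeq X
  -- The distances to a dense sequence reduce the claim to differentiability of real absolutely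
  -- continuous functions.
  let φ : ℕ → ℝ → ℝ := fun n t => dist (f t) (x n)
  have hii : ∀ {k : ℝ → ℝ}, IntervalIntegrable k volume a b → ∀ s ∈ Icc a b, ∀ t ∈ Icc a b,
      IntervalIntegrable k volume s t := fun hk s hs t ht =>
    hk.mono_set (by rw [uIcc_of_le hab]; exact uIcc_subset_Icc hs ht)
  have hsub : ∀ {k : ℝ → ℝ}, IntervalIntegrable k volume a b → ∀ s ∈ Icc a b, ∀ t ∈ Icc a b,
      (∫ r in a..t, k r) - ∫ r in a..s, k r = ∫ r in s..t, k r := fun hk s hs t ht =>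
    intervalIntegral.integral_interval_sub_left (hii hk a (left_mem_Icc.2 hab) t ht)
      (hii hk a (left_mem_Icc.2 hab) s hs)
  have hdist : ∀ {k : ℝ → ℝ}, IntervalIntegrable k volume a b →
      (∀ s ∈ Icc a b, ∀ t ∈ Icc a b, s ≤ t → dist (f s) (f t) ≤ ∫ r in s..t, k r) →
      ∀ s ∈ Icc a b, ∀ t ∈ Icc a b,
      dist (f s) (f t) ≤ |(∫ r in a..s, k r) - ∫ r in a..t, k r| := by
    intro k hk hle s hs t ht
    rcases le_total s t with hst | hst
    · rw [abs_sub_comm, hsub hk s hs t ht]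
      exact (hle s hs t ht hst).trans (le_abs_self _)
    · rw [hsub hk t ht s hs, dist_comm]
      exact (hle t ht s hs hst).trans (le_abs_self _)
  have hφd : ∀ n s t, |φ n s - φ n t| ≤ dist (f s) (f t) := fun n s t =>
    abs_dist_sub_le _ _ _
  have hφ : ∀ n, AbsolutelyContinuousOnInterval (φ n) a b := fun n => by
    refine absolutelyContinuousOnInterval_of_dist_le
      (hg.absolutelyContinuousOnInterval_intervalIntegral (c := a) (by simp)) fun s hs t ht => ?_
    rw [uIcc_of_le hab] at hs ht
    rw [Real.dist_eq, Real.dist_eq]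
    exact (hφd n s t).trans (hdist hg h s hs t ht)
  have hle : ∀ᵐ t, t ∈ Ioo a b → ∀ n, HasDerivAt (φ n) (deriv (φ n) t) t ∧
      |deriv (φ n) t| ≤ g t := by
    filter_upwards [ae_all_iff.2 fun n => (hφ n).ae_differentiableAt, hg.ae_hasDerivAt_integral]
      with t h1 h2 ht n
    have ht' : t ∈ uIcc a b := by rw [uIcc_of_le hab]; exact Ioo_subset_Icc_self ht
    have hd := (h1 n ht').hasDerivAt
    refine ⟨hd, ?_⟩
    have hG := h2 ht' a (by simp)
    have hG' : Tendsto (slope (fun x => ∫ r in a..x, g r) t) (𝓝[>] t) (𝓝 (g t)) :=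
      (hasDerivAt_iff_tendsto_slope.1 hG).mono_left (nhdsGT_le_nhdsNE t)
    have hd' : Tendsto (fun s => |slope (φ n) t s|) (𝓝[>] t) (𝓝 |deriv (φ n) t|) :=
      ((hasDerivAt_iff_tendsto_slope.1 hd).mono_left (nhdsGT_le_nhdsNE t)).abs
    refine le_of_tendsto_of_tendsto hd' hG' ?_
    filter_upwards [Ioo_mem_nhdsGT ht.2] with s hs
    have hs' : s ∈ Icc a b := ⟨(ht.1.trans hs.1).le, hs.2.le⟩
    have hst : 0 < s - t := sub_pos.2 hs.1
    rw [slope_def_field, slope_def_field, abs_div, abs_of_pos hst,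
      hsub hg t (Ioo_subset_Icc_self ht) s hs']
    gcongr
    calc |φ n s - φ n t| = |φ n t - φ n s| := abs_sub_comm _ _
      _ ≤ _ := (hφd n t s).trans (h t (Ioo_subset_Icc_self ht) s hs' hs.1.le)
  -- This supremum will be the metric derivative. It bounds the quotients from below since `|φ n s -
  -- φ n t| ≤ dist (f s) (f t)`, and from above by Lebesgue differentiation, once `m` itself is
  -- shown to control increments.
  let m : ℝ → ℝ := fun t => ⨆ n, |deriv (φ n) t|
  have hmm : Measurable m := Measurable.iSup fun n => (measurable_deriv (φ n)).abs
  have hm0 : ∀ t, 0 ≤ m t := fun t => Real.iSup_nonneg fun n => abs_nonneg _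
  have hbdd : ∀ {t}, (∀ n, HasDerivAt (φ n) (deriv (φ n) t) t ∧ |deriv (φ n) t| ≤ g t) →
      BddAbove (range fun n => |deriv (φ n) t|) := fun {t} ht =>
    ⟨g t, by rintro _ ⟨n, rfl⟩; exact (ht n).2⟩
  have hIoo : ∀ {p : ℝ → Prop}, (∀ᵐ t, t ∈ Ioo a b → p t) → ∀ᵐ t, t ∈ uIoc a b → p t := by
    intro p hp
    have hb : ∀ᵐ t : ℝ, t ≠ b := by simp [ae_iff, measure_singleton]
    filter_upwards [hp, hb] with t h1 h2 h3
    rw [uIoc_of_le hab] at h3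
    exact h1 ⟨h3.1, lt_of_le_of_ne h3.2 h2⟩
  have hmi : IntervalIntegrable m volume a b := by
    refine hg.mono_fun hmm.aestronglyMeasurable ?_
    refine (ae_restrict_iff' measurableSet_uIoc).2 (hIoo ?_)
    filter_upwards [hle] with t ht hmem
    rw [Real.norm_of_nonneg (hm0 t)]
    exact (ciSup_le fun n => (ht hmem n).2).trans (le_abs_self _)
  have hmd : ∀ s ∈ Icc a b, ∀ t ∈ Icc a b, s ≤ t → dist (f s) (f t) ≤ ∫ r in s..t, m r := by
    intro s hs t ht hst
    refine le_of_forall_pos_le_add fun ε hε => ?_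
    -- For `x n` close to `f t`, the increment of `φ n` from `s` to `t` nearly equals the distance
    -- in absolute value.
    obtain ⟨n, hn⟩ := (TopologicalSpace.denseRange_denseSeq X).exists_dist_lt (f t)
      (half_pos hε)
    have hsb : uIcc s t ⊆ uIcc a b := by rw [uIcc_of_le hab]; exact uIcc_subset_Icc hs ht
    have h1 : φ n s - φ n t ≤ ∫ r in s..t, m r := by
      have h2 := ((hφ n).mono hsb).integral_deriv_eq_sub
      have h3 : |∫ r in s..t, deriv (φ n) r| ≤ ∫ r in s..t, m r := by
        rw [← Real.norm_eq_abs]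
        refine intervalIntegral.norm_integral_le_of_norm_le hst ?_ (hii hmi s hs t ht)
        filter_upwards [hIoo hle, hIoo (p := fun t => ∀ n, |deriv (φ n) t| ≤ m t)
          (by filter_upwards [hle] with t ht hmem n; exact le_ciSup (hbdd (ht hmem)) n)]
          with r _ h2 hr
        refine h2 ?_ n
        rw [uIoc_of_le hab]
        exact ⟨hs.1.trans_lt hr.1, hr.2.trans ht.2⟩
      rw [h2] at h3
      linarith [neg_abs_le (φ n t - φ n s)]
    have h4 : dist (f s) (f t) ≤ φ n s + φ n t := dist_triangle_right _ _ _
    have h5 : φ n t < ε / 2 := hn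
    linarith
  filter_upwards [hle, hmi.ae_hasDerivAt_integral] with t h1 h2 ht
  have ht' : t ∈ Icc a b := Ioo_subset_Icc_self ht
  refine ⟨m t, hm0 t, ciSup_le fun n => (h1 ht n).2, ?_⟩
  have hM := h2 (by rwa [uIcc_of_le hab]) a (by simp)
  have hMs := (hasDerivAt_iff_tendsto_slope.1 hM).abs
  rw [abs_of_nonneg (hm0 t)] at hMs
  refine tendsto_order.2 ⟨fun c hc => ?_, fun c hc => ?_⟩
  · obtain ⟨n, hn⟩ := exists_lt_of_lt_ciSup hc
    have hs := (hasDerivAt_iff_tendsto_slope.1 (h1 ht n).1).abs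
    filter_upwards [(tendsto_order.1 hs).1 c hn] with s hcs
    refine hcs.trans_le ?_
    rw [slope_def_field, abs_div]
    gcongr
    exact hφd n s t
  · have hIcc : ∀ᶠ s in 𝓝[≠] t, s ∈ Icc a b :=
      mem_nhdsWithin_of_mem_nhds (Icc_mem_nhds ht.1 ht.2)
    filter_upwards [(tendsto_order.1 hMs).2 c hc, hIcc] with s hcs hs
    refine lt_of_le_of_lt ?_ hcs
    rw [slope_def_field, abs_div]
    gcongr
    exact hdist hmi hmd s hs t ht'

theorem metricSpeed_eq_of_tendsto {X : Type*} [MetricSpace X] {γ : C(unitInterval, X)}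
    {t : unitInterval} {v : ℝ≥0∞}
    (h : Tendsto (fun s => edist (γ s) (γ t) / edist s t) (𝓝[≠] t) (𝓝 v)) :
    metricSpeed γ t = v := by
  have hex : ∃ v : ℝ≥0∞, Tendsto (fun s => edist (γ s) (γ t) / edist s t) (𝓝[≠] t) (𝓝 v) := ⟨v, h⟩
  rw [metricSpeed, dif_pos hex]
  exact tendsto_nhds_unique hex.choose_spec h

/-- A density controlling the increments of a curve dominates the metric speed. -/
theorem ae_metricSpeed_le {X : Type*} [MetricSpace X] [TopologicalSpace.SeparableSpace X]
    {γ : C(unitInterval, X)} {g : unitInterval → ℝ} (hg : Integrable g volume)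
    (h : ∀ s t : unitInterval, s < t → dist (γ s) (γ t) ≤ ∫ r in Icc s t, g r) :
    ∀ᵐ t, metricSpeed γ t ≤ ENNReal.ofReal (g t) := by
  let f : ℝ → X := IccExtend zero_le_one γ
  let k : ℝ → ℝ := IccExtend zero_le_one g
  have hf : ∀ t : unitInterval, f t = γ t := fun t => IccExtend_val _ _ t
  have hk : ∀ t : unitInterval, k t = g t := fun t => IccExtend_val _ _ t
  have hkI : IntegrableOn k (Icc 0 1) volume := by
    refine (unitInterval.measurePreserving_coe.integrable_comp_emb
      unitInterval.measurableEmbedding_coe).1 ?_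
    exact hg.congr (Eventually.of_forall fun t => (hk t).symm)
  have hint : ∀ s t : unitInterval, s ≤ t →
      ∫ r in Icc s t, g r = ∫ r in (s : ℝ)..t, k r := by
    intro s t hst
    have h1 := unitInterval.measurePreserving_coe.setIntegral_preimage_emb
      unitInterval.measurableEmbedding_coe k (Icc (s : ℝ) t)
    have h2 : (Subtype.val : unitInterval → ℝ) ⁻¹' Icc (s : ℝ) t = Icc s t := by ext; simp
    rw [h2, Measure.restrict_restrict measurableSet_Icc,
      inter_eq_self_of_subset_left (Icc_subset_Icc s.2.1 t.2.2)] at h1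
    simp only [hk] at h1
    rw [h1, intervalIntegral.integral_of_le hst, integral_Icc_eq_integral_Ioc]
  have key := ae_exists_tendsto_metricDerivative (f := f) (g := k) zero_le_one
    (by rw [intervalIntegrable_iff_integrableOn_Icc_of_le zero_le_one]; exact hkI) (by
      intro s hs t ht hst
      rcases hst.eq_or_lt with rfl | hlt
      · simp
      · have := h ⟨s, hs⟩ ⟨t, ht⟩ hlt
        rw [hint _ _ hst, ← hf, ← hf] at this
        exact this)
  have key' : ∀ᵐ t : unitInterval, (t : ℝ) ∈ Ioo (0 : ℝ) 1 → ∃ v, 0 ≤ v ∧ v ≤ k t ∧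
      Tendsto (fun s => dist (f s) (f t) / |s - t|) (𝓝[≠] (t : ℝ)) (𝓝 v) :=
    unitInterval.measurePreserving_coe.quasiMeasurePreserving.ae (ae_restrict_of_ae key)
  have h0 : ∀ᵐ t : unitInterval, t ≠ 0 := by simp [ae_iff, measure_singleton]
  have h1 : ∀ᵐ t : unitInterval, t ≠ 1 := by simp [ae_iff, measure_singleton]
  filter_upwards [key', h0, h1] with t ht ht0 ht1
  obtain ⟨v, _, hvg, hv⟩ := ht ⟨unitInterval.pos_iff_ne_zero.2 ht0,
    unitInterval.lt_one_iff_ne_one.2 ht1⟩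
  rw [hk] at hvg
  refine (metricSpeed_eq_of_tendsto (v := ENNReal.ofReal v) ?_).trans_le
    (ENNReal.ofReal_le_ofReal hvg)
  have hcoe : Tendsto (Subtype.val : unitInterval → ℝ) (𝓝[≠] t) (𝓝[≠] (t : ℝ)) :=
    tendsto_nhdsWithin_of_tendsto_nhds_of_eventually_within _
      (continuous_subtype_val.continuousAt.mono_left nhdsWithin_le_nhds)
      (by filter_upwards [self_mem_nhdsWithin] with s hs using fun h => hs (Subtype.ext h))
  refine (ENNReal.tendsto_ofReal (hv.comp hcoe)).congr' ?_
  filter_upwards [self_mem_nhdsWithin] with s hs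
  have hpos : 0 < |(s : ℝ) - t| := abs_pos.2 (sub_ne_zero.2 fun h => hs (Subtype.ext h))
  simp only [Function.comp, hf]
  rw [ENNReal.ofReal_div_of_pos hpos, edist_dist, edist_dist, Subtype.dist_eq, Real.dist_eq]

theorem mem_acCurves_one_iff {X : Type*} [MetricSpace X] {γ : C(unitInterval, X)} :
    γ ∈ acCurves X 1 ↔ ∃ g : unitInterval → ℝ, (∀ r, 0 ≤ g r) ∧ Integrable g volume ∧
      ∀ s t : unitInterval, s < t → dist (γ s) (γ t) ≤ ∫ r in Icc s t, g r := by
  simp only [acCurves, mem_ofPred_eq, memLp_one_iff_integrable]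

/-- The energy of a curve is bounded by that of any density controlling its increments. -/
theorem curveEnergy_le {X : Type*} [MetricSpace X] [TopologicalSpace.SeparableSpace X]
    {γ : C(unitInterval, X)} {g : unitInterval → ℝ} {q : ℝ≥0∞} (hq : 1 ≤ q)
    (hg0 : ∀ r, 0 ≤ g r) (hg : MemLp g q volume)
    (h : ∀ s t : unitInterval, s < t → dist (γ s) (γ t) ≤ ∫ r in Icc s t, g r) :
    curveEnergy q γ ≤ if q = ∞ then essSup (fun t => ENNReal.ofReal (g t)) volume
      else ∫⁻ t, ENNReal.ofReal (g t) ^ q.toReal := by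
  have hs := ae_metricSpeed_le (hg.integrable hq) h
  rw [curveEnergy, if_pos ⟨g, hg0, hg, h⟩]
  split_ifs with hq'
  · exact essSup_mono_ae hs
  · refine lintegral_mono_ae ?_
    filter_upwards [hs] with t ht
    exact ENNReal.rpow_le_rpow ht ENNReal.toReal_nonneg

/-! ### Lipschitz, absolutely continuous and rectifiable curves -/

theorem unitInterval_Icc_zero_one : Icc (0 : unitInterval) 1 = univ :=
  eq_univ_of_forall fun t => ⟨t.2.1, t.2.2⟩

/-- The increments are controlled by those of a monotone real function, the primitive of the
density, whose variation is finite. -/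
theorem acCurves_one_subset_rectifiableCurves {X : Type*} [MetricSpace X] :
    acCurves X 1 ⊆ rectifiableCurves X := by
  intro γ hγ
  obtain ⟨g, hg0, hg, h⟩ := mem_acCurves_one_iff.1 hγ
  let F : unitInterval → ℝ := fun t => ∫ r in Iic t, g r
  have hF : ∀ s t, s ≤ t → edist (γ t) (γ s) ≤ edist (F t) (F s) := by
    intro s t hst
    rcases hst.eq_or_lt with rfl | hlt
    · simp
    rw [edist_comm, edist_dist, edist_dist, Real.dist_eq]
    refine ENNReal.ofReal_le_ofReal ((h s t hlt).trans ((le_of_eq ?_).trans (le_abs_self _)))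
    have h1 : Iic t = Iic s ∪ Ioc s t := (Iic_union_Ioc_eq_Iic hst).symm
    simp only [F]
    have hd : Disjoint (Iic s) (Ioc s t) :=
      Set.disjoint_left.2 fun x hx hx' => not_lt.2 (mem_Iic.1 hx) hx'.1
    rw [integral_Icc_eq_integral_Ioc, h1,
      setIntegral_union hd measurableSet_Ioc hg.integrableOn hg.integrableOn]
    ring
  have hFm : Monotone F := fun s t hst =>
    setIntegral_mono_set hg.integrableOn (Eventually.of_forall hg0)
      (Iic_subset_Iic.2 hst).eventuallyLE
  have hle : eVariationOn γ univ ≤ eVariationOn F univ := by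
    refine iSup_mono fun p => Finset.sum_le_sum fun i _ => hF _ _ (p.2.2.1 (Nat.le_succ i))
  refine hle.trans_lt ?_
  have h01 := (hFm.monotoneOn univ).eVariationOn_eq (mem_univ 0) (mem_univ 1)
  rw [univ_inter, unitInterval_Icc_zero_one] at h01
  exact h01 ▸ ENNReal.ofReal_lt_top

theorem lipschitzCurves_subset_acCurves {X : Type*} [MetricSpace X] (q : ℝ≥0∞) :
    lipschitzCurves X ⊆ acCurves X q := by
  rintro γ ⟨K, hK⟩
  refine ⟨fun _ => K, fun _ => K.2, memLp_const _, fun s t hst => ?_⟩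
  have h1 : volume.real (Icc s t) = (t : ℝ) - s := by
    rw [Measure.real, unitInterval.volume_Icc, ENNReal.toReal_ofReal (sub_nonneg.2 hst.le)]
  rw [setIntegral_const, h1, smul_eq_mul, mul_comm]
  refine (hK.dist_le_mul s t).trans_eq ?_
  rw [Subtype.dist_eq, Real.dist_eq, abs_sub_comm,
    abs_of_pos (sub_pos.2 (show (s : ℝ) < t from hst))]

theorem length_le_of_lipschitzWith {X : Type*} [MetricSpace X] {γ : C(unitInterval, X)} {K : ℝ≥0}
    (hK : LipschitzWith K γ) : length γ ≤ K := by
  have h1 := (hK.lipschitzOnWith (s := univ)).comp_eVariationOn_le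
    (f := γ) (g := (id : unitInterval → unitInterval)) (s := univ) (mapsTo_univ _ _)
  have h2 : eVariationOn (id : unitInterval → unitInterval) univ = 1 := by
    have h := ((Subtype.mono_coe (· ∈ unitInterval)).monotoneOn univ).eVariationOn_eq
      (mem_univ (0 : unitInterval)) (mem_univ 1)
    rw [univ_inter, unitInterval_Icc_zero_one] at h
    refine (show _ = eVariationOn (fun t : unitInterval => (t : ℝ)) univ from rfl).trans (h.trans ?_)
    simp
  rw [h2, mul_one] at h1
  exact h1

/-! ### The length measure as a kernel -/

section LengthMeasure

variable {X : Type*} [MetricSpace X]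

/-- Variation is lower semicontinuous even for pointwise convergence. -/
theorem measurable_eVariationOn (s : Set unitInterval) :
    Measurable fun γ : C(unitInterval, X) => eVariationOn γ s := by
  have : LowerSemicontinuous fun γ : C(unitInterval, X) => eVariationOn γ s := fun γ v hv =>
    eVariationOn.lowerSemicontinuous_aux
      (fun x _ => (continuous_eval_const x).continuousAt) hv
  exact this.measurable

theorem measurable_length : Measurable (length : C(unitInterval, X) → ℝ≥0∞) :=
  measurable_eVariationOn univ

theorem measurableSet_rectifiableCurves : MeasurableSet (rectifiableCurves X) :=
  measurableSet_lt measurable_length measurable_const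

theorem lengthMeasure_Ioc {γ : C(unitInterval, X)} (hγ : γ ∈ rectifiableCurves X)
    {a b : unitInterval} (hab : a ≤ b) :
    lengthMeasure γ (Ioc a b) = eVariationOn γ (Icc a b) := by
  have hb : BoundedVariationOn γ univ := ne_of_lt hγ
  rw [lengthMeasure, dif_pos hγ, StieltjesFunction.measure_Ioc]
  change ENNReal.ofReal (variationOnFromTo γ univ 0 b - variationOnFromTo γ univ 0 a) = _
  rw [variationOnFromTo.sub_right hb.locallyBoundedVariationOn (mem_univ _) (mem_univ _)
    (mem_univ _), variationOnFromTo.eq_of_le _ _ hab, univ_inter, ENNReal.ofReal_toReal]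
  exact hb.mono (subset_univ _)

variable [CompleteSpace X]

instance nullSingletonClass_lengthMeasure (γ : C(unitInterval, X)) :
    NullSingletonClass (lengthMeasure γ) where
  measure_singleton a := by
    rw [lengthMeasure]
    split_ifs with hγ
    · have hb : BoundedVariationOn γ univ := ne_of_lt hγ
      rw [StieltjesFunction.measure_singleton]
      change ENNReal.ofReal (variationOnFromTo γ univ 0 a -
        (variationOnFromTo γ univ 0).leftLim a) = 0
      rw [variationOnFromTo.leftLim_eq hb, γ.continuous.continuousAt.continuousWithinAt.leftLim_eq]
      simp
    · simp

theorem lengthMeasure_Iic {γ : C(unitInterval, X)} (hγ : γ ∈ rectifiableCurves X)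
    (b : unitInterval) : lengthMeasure γ (Iic b) = eVariationOn γ (Icc 0 b) := by
  have h : Iic b = Icc 0 b := by ext x; simp
  rw [← lengthMeasure_Ioc hγ b.2.1, h]
  exact (measure_congr Ioc_ae_eq_Icc).symm

theorem lengthMeasure_univ {γ : C(unitInterval, X)} (hγ : γ ∈ rectifiableCurves X) :
    lengthMeasure γ univ = length γ := by
  have h : (univ : Set unitInterval) = Iic 1 := (eq_univ_of_forall fun t => t.2.2).symm
  rw [length, h, lengthMeasure_Iic hγ, ← h, unitInterval_Icc_zero_one]

instance isFiniteMeasure_lengthMeasure (γ : C(unitInterval, X)) :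
    IsFiniteMeasure (lengthMeasure γ) where
  measure_univ_lt_top := by
    by_cases hγ : γ ∈ rectifiableCurves X
    · rw [lengthMeasure_univ hγ]
      exact hγ
    · simp [lengthMeasure, hγ]

theorem lengthMeasure_Iic_eq_indicator (γ : C(unitInterval, X)) (b : unitInterval) :
    lengthMeasure γ (Iic b) =
      (rectifiableCurves X).indicator (fun γ => eVariationOn γ (Icc 0 b)) γ := by
  by_cases hγ : γ ∈ rectifiableCurves X
  · rw [indicator_of_mem hγ, lengthMeasure_Iic hγ]
  · rw [indicator_of_notMem hγ, lengthMeasure, dif_neg hγ]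
    rfl

/-- The initial segments form a generating π-system, and on them the length measure is a variation.
-/
theorem measurable_lengthMeasure :
    Measurable (lengthMeasure : C(unitInterval, X) → Measure unitInterval) := by
  have hI : ∀ b, Measurable fun γ : C(unitInterval, X) => lengthMeasure γ (Iic b) := by
    intro b
    simp only [lengthMeasure_Iic_eq_indicator]
    exact (measurable_eVariationOn _).indicator measurableSet_rectifiableCurves
  refine Measurable.measure_of_isPiSystem
    ((borel_eq_generateFrom_Iic unitInterval).symm ▸ BorelSpace.measurable_eq)
    isPiSystem_Iic ?_ ?_
  · rintro _ ⟨b, rfl⟩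
    exact hI b
  · have h : (univ : Set unitInterval) = Iic 1 := (eq_univ_of_forall fun t => t.2.2).symm
    rw [h]
    exact hI 1

open scoped Classical in
/-- The length measures of the curves of length at most `K`, as a finite kernel. -/
def lengthKernel (X : Type*) [MetricSpace X] [CompleteSpace X] (K : ℝ≥0) :
    ProbabilityTheory.Kernel C(unitInterval, X) unitInterval where
  -- The cut-off bounds the total masses uniformly, so that the kernel is finite and integrals
  -- against it depend measurably on the curve.
  toFun γ := if length γ ≤ K then lengthMeasure γ else 0
  measurable' := Measurable.ite (measurableSet_le measurable_length measurable_const)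
    measurable_lengthMeasure measurable_const

theorem lengthKernel_of_le {K : ℝ≥0} {γ : C(unitInterval, X)} (h : length γ ≤ K) :
    lengthKernel X K γ = lengthMeasure γ := if_pos h

theorem lengthKernel_of_not_le {K : ℝ≥0} {γ : C(unitInterval, X)} (h : ¬ length γ ≤ K) :
    lengthKernel X K γ = 0 := if_neg h

theorem lengthKernel_univ_le (K : ℝ≥0) (γ : C(unitInterval, X)) :
    lengthKernel X K γ univ ≤ K := by
  by_cases h : length γ ≤ K
  · rw [lengthKernel_of_le h, lengthMeasure_univ (h.trans_lt ENNReal.coe_lt_top)]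
    exact h
  · simp [lengthKernel_of_not_le h]

instance isFiniteKernel_lengthKernel (K : ℝ≥0) :
    ProbabilityTheory.IsFiniteKernel (lengthKernel X K) :=
  ⟨K, ENNReal.coe_lt_top, lengthKernel_univ_le K⟩

instance nullSingletonClass_lengthKernel (K : ℝ≥0) (γ : C(unitInterval, X)) :
    NullSingletonClass (lengthKernel X K γ) where
  measure_singleton a := by
    by_cases h : length γ ≤ K
    · rw [lengthKernel_of_le h, measure_singleton]
    · simp [lengthKernel_of_not_le h]

theorem edist_le_lengthKernel {K : ℝ≥0} {γ : C(unitInterval, X)} (h : length γ ≤ K)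
    {a b : unitInterval} (hab : a ≤ b) : edist (γ a) (γ b) ≤ lengthKernel X K γ (Ioc a b) := by
  rw [lengthKernel_of_le h, lengthMeasure_Ioc (h.trans_lt ENNReal.coe_lt_top) hab]
  exact eVariationOn.edist_le γ (left_mem_Icc.2 hab) (right_mem_Icc.2 hab)

end LengthMeasure

/-! ### Distribution and quantile functions of atomless measures -/

section DistributionFunction

variable (μ : Measure unitInterval) [IsProbabilityMeasure μ]

/-- The distribution function of a probability measure on `[0,1]`. -/
def distFun (t : unitInterval) : unitInterval :=
  ⟨μ.real (Iic t), measureReal_nonneg, measureReal_le_one⟩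

theorem distFun_mono : Monotone (distFun μ) := fun _ _ h =>
  measureReal_mono (Iic_subset_Iic.2 h)

theorem measure_Iic_eq_distFun (t : unitInterval) : μ (Iic t) = ENNReal.ofReal (distFun μ t) :=
  (ofReal_measureReal (measure_ne_top _ _)).symm

theorem measure_Ioc_eq_distFun {s t : unitInterval} (h : s ≤ t) :
    μ (Ioc s t) = ENNReal.ofReal (distFun μ t - distFun μ s) := by
  rw [← Iic_sdiff_Iic, measure_sdiff (Iic_subset_Iic.2 h) measurableSet_Iic.nullMeasurableSet
    (measure_ne_top _ _), measure_Iic_eq_distFun, measure_Iic_eq_distFun,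
    ENNReal.ofReal_sub _ (distFun μ s).2.1]

theorem distFun_one : distFun μ 1 = 1 := by
  have h : Iic (1 : unitInterval) = univ := eq_univ_of_forall fun t => t.2.2
  ext
  simp [distFun, h]

variable [NullSingletonClass μ]

theorem distFun_zero : distFun μ 0 = 0 := by
  have h : Iic (0 : unitInterval) = {0} := by ext x; simp
  ext
  simp [distFun, h, Measure.real]

theorem continuous_distFun : Continuous (distFun μ) := by
  refine Continuous.subtype_mk (continuous_iff_continuousAt.2 fun t => ?_) _
  refine (ENNReal.tendsto_toReal (measure_ne_top _ _)).comp ?_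
  have hind : ∀ s, μ (Iic s) = ∫⁻ r, (Iic s).indicator 1 r ∂μ := fun s =>
    (lintegral_indicator_one measurableSet_Iic).symm
  simp only [hind]
  refine tendsto_lintegral_filter_of_dominated_convergence (fun _ => 1)
    (Eventually.of_forall fun s => measurable_one.indicator measurableSet_Iic)
    (Eventually.of_forall fun s => Eventually.of_forall fun r => indicator_le_self' (by simp) r)
    (by simp) ?_
  have ht : ∀ᵐ r ∂μ, r ≠ t := by simp [ae_iff, measure_singleton]
  filter_upwards [ht] with r hr
  rcases lt_or_gt_of_ne hr with h | h
  · refine tendsto_const_nhds.congr' ?_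
    filter_upwards [lt_mem_nhds h] with s hs
    rw [indicator_of_mem (mem_Iic.2 h.le), indicator_of_mem (mem_Iic.2 hs.le)]
  · refine tendsto_const_nhds.congr' ?_
    filter_upwards [gt_mem_nhds h] with s hs
    rw [indicator_of_notMem (by simpa using h), indicator_of_notMem (by simpa using hs)]

theorem surjective_distFun : Function.Surjective (distFun μ) := by
  intro s
  have h := intermediate_value_Icc (zero_le_one (α := unitInterval))
    (continuous_distFun μ).continuousOn
  rw [distFun_zero, distFun_one] at h
  obtain ⟨t, _, ht⟩ := h ⟨s.2.1, s.2.2⟩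
  exact ⟨t, ht⟩

theorem exists_isLeast_distFun_preimage (s : unitInterval) :
    ∃ t, IsLeast (distFun μ ⁻¹' {s}) t :=
  (isClosed_singleton.preimage (continuous_distFun μ)).isCompact.exists_isLeast
    (surjective_distFun μ s)

/-- The quantile function of an atomless probability measure on `[0,1]`: the least right inverse of
the distribution function. -/
def quantile (s : unitInterval) : unitInterval := (exists_isLeast_distFun_preimage μ s).choose

theorem distFun_quantile (s : unitInterval) : distFun μ (quantile μ s) = s :=
  (exists_isLeast_distFun_preimage μ s).choose_spec.1

/-- This Galois connection yields the monotonicity of the quantile, its measurable dependence on the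
measure, and the probability integral transform. -/
theorem quantile_le_iff {s t : unitInterval} : quantile μ s ≤ t ↔ s ≤ distFun μ t := by
  refine ⟨fun h => ?_, fun h => ?_⟩
  · rw [← distFun_quantile μ s]
    exact distFun_mono μ h
  · by_contra! hlt
    have h1 : distFun μ t ≤ s := by
      rw [← distFun_quantile μ s]
      exact distFun_mono μ hlt.le
    exact not_lt.2 ((exists_isLeast_distFun_preimage μ s).choose_spec.2 (le_antisymm h1 h)) hlt

/-- The probability integral transform. -/
theorem map_distFun : μ.map (distFun μ) = volume := by
  have hm : Measurable (distFun μ) := (continuous_distFun μ).measurable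
  have : IsProbabilityMeasure (μ.map (distFun μ)) :=
    Measure.isProbabilityMeasure_map hm.aemeasurable
  refine Measure.ext_of_Ici _ _ fun s => ?_
  have hpre : distFun μ ⁻¹' Ici s = Icc (quantile μ s) 1 := by
    ext t
    simp [← quantile_le_iff, unitInterval.le_one']
  rw [Measure.map_apply hm measurableSet_Ici, hpre, ← measure_congr Ioc_ae_eq_Icc,
    measure_Ioc_eq_distFun μ unitInterval.le_one', distFun_one, distFun_quantile,
    unitInterval.volume_Ici]
  simp

end DistributionFunction

/-! ### Reparametrization by a time measure -/

section QuantileReparam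

variable {X : Type*} [MetricSpace X]

theorem quantile_mono (μ : Measure unitInterval) [IsProbabilityMeasure μ] [NullSingletonClass μ] :
    Monotone (quantile μ) := fun s t h =>
  (quantile_le_iff μ).2 (by rwa [distFun_quantile])

variable (μ : Measure unitInterval) [IsProbabilityMeasure μ] [NullSingletonClass μ]
  (γ : C(unitInterval, X))

/-- A curve that is constant on the intervals that `μ` neglects is a function of the distribution
function of `μ`. -/
theorem apply_quantile_distFun (h : ∀ a b, a ≤ b → μ (Ioc a b) = 0 → γ a = γ b)
    (t : unitInterval) : γ (quantile μ (distFun μ t)) = γ t := by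
  have hle : quantile μ (distFun μ t) ≤ t := (quantile_le_iff μ).2 le_rfl
  exact h _ _ hle (by rw [measure_Ioc_eq_distFun μ hle, distFun_quantile]; simp)

/-- The curve `γ`, parametrized by the distribution function of `μ`. -/
def quantileReparam (h : ∀ a b, a ≤ b → μ (Ioc a b) = 0 → γ a = γ b) : C(unitInterval, X) where
  toFun s := γ (quantile μ s)
  continuous_toFun := by
    -- The quantile function may jump, so continuity is checked after composing with the
    -- distribution function, which gives back `γ`.
    have hq : IsQuotientMap (distFun μ) :=
      (continuous_distFun μ).isClosedMap.isQuotientMap (continuous_distFun μ)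
        (surjective_distFun μ)
    rw [hq.continuous_iff]
    exact γ.continuous.congr fun t => (apply_quantile_distFun μ γ h t).symm

variable (h : ∀ a b, a ≤ b → μ (Ioc a b) = 0 → γ a = γ b)

theorem quantileReparam_distFun (t : unitInterval) :
    quantileReparam μ γ h (distFun μ t) = γ t := apply_quantile_distFun μ γ h t

theorem isReparametrization_quantileReparam : IsReparametrization γ (quantileReparam μ γ h) :=
  ⟨distFun μ, distFun_mono μ, continuous_distFun μ, surjective_distFun μ,
    fun t => (quantileReparam_distFun μ γ h t).symm⟩

theorem quantileReparam_zero : quantileReparam μ γ h 0 = γ 0 := by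
  rw [← quantileReparam_distFun μ γ h, distFun_zero]

theorem quantileReparam_one : quantileReparam μ γ h 1 = γ 1 := by
  rw [← quantileReparam_distFun μ γ h, distFun_one]

theorem lintegral_quantileReparam [MeasurableSpace X] [BorelSpace X] {F : X → ℝ≥0∞}
    (hF : Measurable F) : ∫⁻ r, F (quantileReparam μ γ h r) = ∫⁻ t, F (γ t) ∂μ := by
  have hm : Measurable fun r => F (quantileReparam μ γ h r) :=
    hF.comp (quantileReparam μ γ h).continuous.measurable
  rw [← map_distFun μ, lintegral_map hm
    (continuous_distFun μ).measurable]
  simp only [quantileReparam_distFun]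

/-- A speed `k` of `γ` relative to `μ` becomes a speed relative to Lebesgue measure, because the
distribution function pushes `μ` to it and sends the interval between two quantiles into `Icc s t`.
-/
theorem edist_quantileReparam_le [MeasurableSpace X] [BorelSpace X] {k : X → ℝ≥0∞}
    (hk : Measurable k)
    (hd : ∀ a b, a ≤ b → edist (γ a) (γ b) ≤ ∫⁻ t in Ioc a b, k (γ t) ∂μ)
    {s t : unitInterval} (hst : s ≤ t) :
    edist (quantileReparam μ γ h s) (quantileReparam μ γ h t) ≤
      ∫⁻ r in Icc s t, k (quantileReparam μ γ h r) := by
  refine (hd _ _ (quantile_mono μ hst)).trans ?_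
  have hm : Measurable fun r => k (quantileReparam μ γ h r) :=
    hk.comp (quantileReparam μ γ h).continuous.measurable
  rw [← map_distFun μ, setLIntegral_map measurableSet_Icc hm (continuous_distFun μ).measurable]
  simp only [quantileReparam_distFun]
  refine lintegral_mono_set fun u hu => ?_
  constructor
  · rw [← distFun_quantile μ s]
    exact distFun_mono μ hu.1.le
  · rw [← distFun_quantile μ t]
    exact distFun_mono μ hu.2

end QuantileReparam

theorem dist_le_setIntegral_of_edist_le {X : Type*} [MetricSpace X] {η : C(unitInterval, X)}
    {k : unitInterval → ℝ≥0} (hk : Integrable (fun r => (k r : ℝ)) volume)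
    {s t : unitInterval} (h : edist (η s) (η t) ≤ ∫⁻ r in Icc s t, k r) :
    dist (η s) (η t) ≤ ∫ r in Icc s t, (k r : ℝ) := by
  have h0 : 0 ≤ ∫ r in Icc s t, (k r : ℝ) := integral_nonneg fun r => (k r).2
  rw [← ENNReal.ofReal_le_ofReal_iff h0, ← edist_dist, ofReal_integral_eq_lintegral_ofReal
    hk.integrableOn (Eventually.of_forall fun r => (k r).2)]
  simpa only [ENNReal.ofReal_coe_nnreal] using h

/-! ### Reparametrization with speed proportional to `ρ` -/

section SlowedReparam

variable {X : Type*} [MetricSpace X] [CompleteSpace X]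

/-- The total weight that the speed density `1 / ρ` gives to a curve of length at most `K`. -/
def slowedLength (K : ℝ≥0) (ρ : X → ℝ≥0) (γ : C(unitInterval, X)) : ℝ≥0∞ :=
  ∫⁻ t, (ρ (γ t) : ℝ≥0∞)⁻¹ ∂lengthKernel X K γ

open scoped Classical in
/-- The normalized measure with density `1 / ρ` with respect to the length measure. For curves on
which this cannot be normalized it is the Lebesgue measure. -/
def timeMeasure (K : ℝ≥0) (ρ : X → ℝ≥0) (γ : C(unitInterval, X)) : Measure unitInterval :=
  if slowedLength K ρ γ = 0 ∨ slowedLength K ρ γ = ∞ then volume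
  else (slowedLength K ρ γ)⁻¹ •
    (lengthKernel X K γ).withDensity fun t => (ρ (γ t) : ℝ≥0∞)⁻¹

variable {K : ℝ≥0} {ρ : X → ℝ≥0} {γ : C(unitInterval, X)}

instance isProbabilityMeasure_timeMeasure : IsProbabilityMeasure (timeMeasure K ρ γ) := by
  unfold timeMeasure
  split_ifs with h
  · infer_instance
  · push Not at h
    constructor
    rw [Measure.smul_apply, withDensity_apply _ MeasurableSet.univ, Measure.restrict_univ,
      smul_eq_mul]
    exact ENNReal.inv_mul_cancel h.1 h.2

instance nullSingletonClass_timeMeasure : NullSingletonClass (timeMeasure K ρ γ) where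
  measure_singleton a := by
    unfold timeMeasure
    split_ifs with h
    · exact measure_singleton a
    · rw [Measure.smul_apply, withDensity_absolutelyContinuous _ _ (measure_singleton a), smul_zero]

theorem length_le_of_slowedLength_ne_zero (h : slowedLength K ρ γ ≠ 0) : length γ ≤ K := by
  by_contra hK
  exact h (by simp [slowedLength, lengthKernel_of_not_le hK])

theorem slowedLength_le (h1 : ∀ x, 1 ≤ ρ x) (γ : C(unitInterval, X)) :
    slowedLength K ρ γ ≤ K := by
  calc slowedLength K ρ γ ≤ ∫⁻ _, 1 ∂lengthKernel X K γ :=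
        lintegral_mono fun t => ENNReal.inv_le_one.2 (by exact_mod_cast h1 _)
    _ ≤ K := by simpa using lengthKernel_univ_le K γ

/-- The weight of a curve in the slowed plan. -/
def slowedWeight (K : ℝ≥0) (ρ : X → ℝ≥0) (γ : C(unitInterval, X)) : ℝ≥0∞ :=
  -- The first entry cancels the normalization of the time measure; the other two control the
  -- endpoint terms of the barycenter.
  min (slowedLength K ρ γ) (min (ρ (γ 0) : ℝ≥0∞)⁻¹ (ρ (γ 1) : ℝ≥0∞)⁻¹)

theorem slowedWeight_le_one (h1 : ∀ x, 1 ≤ ρ x) (γ : C(unitInterval, X)) :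
    slowedWeight K ρ γ ≤ 1 :=
  (min_le_right _ _).trans ((min_le_left _ _).trans
    (ENNReal.inv_le_one.2 (by exact_mod_cast h1 _)))

theorem slowedWeight_ne_zero (h : slowedLength K ρ γ ≠ 0) :
    slowedWeight K ρ γ ≠ 0 := by
  have h0 : ∀ x, (ρ x : ℝ≥0∞)⁻¹ ≠ 0 := fun x => ENNReal.inv_ne_zero.2 ENNReal.coe_ne_top
  simp only [slowedWeight, ne_eq, ← pos_iff_ne_zero, lt_min_iff]
  exact ⟨pos_iff_ne_zero.2 h, pos_iff_ne_zero.2 (h0 _), pos_iff_ne_zero.2 (h0 _)⟩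

/-- The total weight of the slowed plan before normalization. -/
def slowedMass (K : ℝ≥0) (ρ : X → ℝ≥0) (π : Measure C(unitInterval, X)) : ℝ≥0∞ :=
  ∫⁻ γ, slowedWeight K ρ γ ∂π

theorem slowedMass_ne_top {π : Measure C(unitInterval, X)} [IsFiniteMeasure π] (h1 : ∀ x, 1 ≤ ρ x) : slowedMass K ρ π ≠ ∞ := by
  refine ((lintegral_mono (slowedWeight_le_one h1)).trans_lt ?_).ne
  simp [measure_lt_top]

variable [MeasurableSpace X] [BorelSpace X]

/-- As `1/ρ` never vanishes, an interval null for the time measure either has zero length measure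
or, in the Lebesgue case, is trivial. -/
theorem eq_of_timeMeasure_Ioc_eq_zero (hρ : Measurable ρ) {a b : unitInterval} (hab : a ≤ b)
    (h : timeMeasure K ρ γ (Ioc a b) = 0) : γ a = γ b := by
  unfold timeMeasure at h
  split_ifs at h with hc
  · rw [unitInterval.volume_Ioc, ENNReal.ofReal_eq_zero, sub_nonpos] at h
    rw [le_antisymm hab h]
  · push Not at hc
    rw [Measure.smul_apply, smul_eq_mul, mul_eq_zero,
      or_iff_right (ENNReal.inv_ne_zero.2 hc.2)] at h
    have hm : Measurable fun t => (ρ (γ t) : ℝ≥0∞)⁻¹ :=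
      (hρ.comp γ.continuous.measurable).coe_nnreal_ennreal.inv
    have h0 := withDensity_absolutelyContinuous' hm.aemeasurable
      (Eventually.of_forall fun t => ENNReal.inv_ne_zero.2 ENNReal.coe_ne_top) h
    have h1 := edist_le_lengthKernel (length_le_of_slowedLength_ne_zero hc.1) hab
    rw [h0] at h1
    exact edist_le_zero.1 h1

/-- The reparametrization of `γ` with speed proportional to `ρ`. -/
def slowedReparam (K : ℝ≥0) {ρ : X → ℝ≥0} (hρ : Measurable ρ) (γ : C(unitInterval, X)) :
    C(unitInterval, X) :=
  quantileReparam (timeMeasure K ρ γ) γ fun _ _ => eq_of_timeMeasure_Ioc_eq_zero hρ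

theorem isReparametrization_slowedReparam (hρ : Measurable ρ) (γ : C(unitInterval, X)) :
    IsReparametrization γ (slowedReparam K hρ γ) :=
  isReparametrization_quantileReparam _ _ _

theorem slowedReparam_zero (hρ : Measurable ρ) (γ : C(unitInterval, X)) :
    slowedReparam K hρ γ 0 = γ 0 :=
  quantileReparam_zero _ _ _

theorem slowedReparam_one (hρ : Measurable ρ) (γ : C(unitInterval, X)) :
    slowedReparam K hρ γ 1 = γ 1 :=
  quantileReparam_one _ _ _

/-- The time measure is then Lebesgue measure, with the identity as distribution function. This
covers constant curves and those longer than `K`. -/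
theorem slowedReparam_of_slowedLength_eq_zero (hρ : Measurable ρ) (h : slowedLength K ρ γ = 0) :
    slowedReparam K hρ γ = γ := by
  ext t
  have ht : distFun (timeMeasure K ρ γ) t = t := by
    ext
    simp [distFun, timeMeasure, h, Measure.real, t.2.1]
  have := quantileReparam_distFun (timeMeasure K ρ γ) γ
    (fun _ _ => eq_of_timeMeasure_Ioc_eq_zero hρ) t
  rwa [ht] at this

theorem lintegral_timeMeasure (hρ : Measurable ρ) (h1 : ∀ x, 1 ≤ ρ x)
    (h : slowedLength K ρ γ ≠ 0) {F : X → ℝ≥0∞} (hF : Measurable F) :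
    ∫⁻ t, F (γ t) ∂timeMeasure K ρ γ = (slowedLength K ρ γ)⁻¹ *
      ∫⁻ t, (ρ (γ t) : ℝ≥0∞)⁻¹ * F (γ t) ∂lengthKernel X K γ := by
  have hm : Measurable fun t => (ρ (γ t) : ℝ≥0∞)⁻¹ :=
    (hρ.comp γ.continuous.measurable).coe_nnreal_ennreal.inv
  have ht : slowedLength K ρ γ ≠ ∞ := ((slowedLength_le h1 γ).trans_lt ENNReal.coe_lt_top).ne
  have hFγ : Measurable fun t => F (γ t) := hF.comp γ.continuous.measurable
  rw [timeMeasure, if_neg (by tauto), lintegral_smul_measure,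
    lintegral_withDensity_eq_lintegral_mul _ hm hFγ, smul_eq_mul]
  rfl

/-- The speed `c ρ` cancels the time density `1/(c ρ)`. -/
theorem setLIntegral_timeMeasure_eq_lengthKernel (hρ : Measurable ρ) (h1 : ∀ x, 1 ≤ ρ x)
    (h : slowedLength K ρ γ ≠ 0) (a b : unitInterval) :
    ∫⁻ t in Ioc a b, (slowedLength K ρ γ).toNNReal * ρ (γ t) ∂timeMeasure K ρ γ =
      lengthKernel X K γ (Ioc a b) := by
  have hm : Measurable fun t => (ρ (γ t) : ℝ≥0∞)⁻¹ :=
    (hρ.comp γ.continuous.measurable).coe_nnreal_ennreal.inv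
  have hm' : Measurable fun t => (ρ (γ t) : ℝ≥0∞) :=
    (hρ.comp γ.continuous.measurable).coe_nnreal_ennreal
  have ht : slowedLength K ρ γ ≠ ∞ := ((slowedLength_le h1 γ).trans_lt ENNReal.coe_lt_top).ne
  rw [ENNReal.coe_toNNReal ht, timeMeasure, if_neg (by tauto), Measure.restrict_smul,
    lintegral_smul_measure, setLIntegral_withDensity_eq_setLIntegral_mul _ hm
      (hm'.const_mul _) measurableSet_Ioc, smul_eq_mul]
  have : ∀ t, ((fun t => (ρ (γ t) : ℝ≥0∞)⁻¹) * fun t => slowedLength K ρ γ * ρ (γ t)) t =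
      slowedLength K ρ γ := fun t => by
    have h0 : (ρ (γ t) : ℝ≥0∞) ≠ 0 := by
      exact_mod_cast (zero_lt_one.trans_le (h1 (γ t))).ne'
    rw [Pi.mul_apply, mul_left_comm, ENNReal.inv_mul_cancel h0 ENNReal.coe_ne_top, mul_one]
  simp only [this]
  rw [setLIntegral_const, ← mul_assoc, ENNReal.inv_mul_cancel h ht, one_mul]

theorem lintegral_slowedReparam (hρ : Measurable ρ) (h1 : ∀ x, 1 ≤ ρ x)
    (h : slowedLength K ρ γ ≠ 0) {F : X → ℝ≥0∞} (hF : Measurable F) :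
    ∫⁻ r, F (slowedReparam K hρ γ r) = (slowedLength K ρ γ)⁻¹ *
      ∫⁻ t, (ρ (γ t) : ℝ≥0∞)⁻¹ * F (γ t) ∂lengthKernel X K γ :=
  (lintegral_quantileReparam _ _ _ hF).trans (lintegral_timeMeasure hρ h1 h hF)

/-- The speed of the reparametrized curve. -/
def slowedSpeed (K : ℝ≥0) {ρ : X → ℝ≥0} (hρ : Measurable ρ) (γ : C(unitInterval, X))
    (r : unitInterval) : ℝ≥0 :=
  (slowedLength K ρ γ).toNNReal * ρ (slowedReparam K hρ γ r)

theorem measurable_slowedSpeed (hρ : Measurable ρ) : Measurable (slowedSpeed K hρ γ) :=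
  (hρ.comp (slowedReparam K hρ γ).continuous.measurable).const_mul _

theorem edist_slowedReparam_le (hρ : Measurable ρ) (h1 : ∀ x, 1 ≤ ρ x)
    (h : slowedLength K ρ γ ≠ 0) {s t : unitInterval} (hst : s ≤ t) :
    edist (slowedReparam K hρ γ s) (slowedReparam K hρ γ t) ≤
      ∫⁻ r in Icc s t, slowedSpeed K hρ γ r := by
  have hk : Measurable fun x => ((slowedLength K ρ γ).toNNReal * ρ x : ℝ≥0∞) :=
    hρ.coe_nnreal_ennreal.const_mul _
  refine (edist_quantileReparam_le _ _ _ hk (fun a b hab => ?_) hst).trans_eq ?_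
  · rw [setLIntegral_timeMeasure_eq_lengthKernel hρ h1 h]
    exact edist_le_lengthKernel (length_le_of_slowedLength_ne_zero h) hab
  · simp only [slowedSpeed, ENNReal.coe_mul]
    rfl

/-- Passing from time to length costs a factor `1/(c ρ)`, which lowers the exponent from `p` to `p -
1`; then `c ≤ K`. -/
theorem lintegral_slowedSpeed_rpow_le (hρ : Measurable ρ) (h1 : ∀ x, 1 ≤ ρ x)
    (h : slowedLength K ρ γ ≠ 0) {p : ℝ} (hp : 1 ≤ p) :
    ∫⁻ r, (slowedSpeed K hρ γ r : ℝ≥0∞) ^ p ≤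
      (K : ℝ≥0∞) ^ (p - 1) * ∫⁻ t, (ρ (γ t) : ℝ≥0∞) ^ (p - 1) ∂lengthKernel X K γ := by
  have ht : slowedLength K ρ γ ≠ ∞ := ((slowedLength_le h1 γ).trans_lt ENNReal.coe_lt_top).ne
  have hF : Measurable fun x => (slowedLength K ρ γ * ρ x) ^ p :=
    (hρ.coe_nnreal_ennreal.const_mul _).pow_const _
  have hm : Measurable fun t => (ρ (γ t) : ℝ≥0∞) ^ (p - 1) :=
    (hρ.comp γ.continuous.measurable).coe_nnreal_ennreal.pow_const _
  have e1 : ∫⁻ r, (slowedSpeed K hρ γ r : ℝ≥0∞) ^ p =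
      ∫⁻ r, (slowedLength K ρ γ * ρ (slowedReparam K hρ γ r)) ^ p := by
    simp only [slowedSpeed, ENNReal.coe_mul, ENNReal.coe_toNNReal ht]
  have e2 : ∀ t, (ρ (γ t) : ℝ≥0∞)⁻¹ * (slowedLength K ρ γ * ρ (γ t)) ^ p =
      slowedLength K ρ γ ^ p * (ρ (γ t) : ℝ≥0∞) ^ (p - 1) := fun t => by
    have h0 : (ρ (γ t) : ℝ≥0∞) ≠ 0 := by
      exact_mod_cast (zero_lt_one.trans_le (h1 (γ t))).ne'
    rw [ENNReal.mul_rpow_of_nonneg _ _ (by linarith), ENNReal.rpow_sub _ _ h0 ENNReal.coe_ne_top,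
      ENNReal.rpow_one, ENNReal.div_eq_inv_mul]
    ring
  rw [e1, lintegral_slowedReparam hρ h1 h hF]
  simp only [e2]
  rw [lintegral_const_mul _ hm, ← mul_assoc]
  gcongr
  calc (slowedLength K ρ γ)⁻¹ * slowedLength K ρ γ ^ p = slowedLength K ρ γ ^ (p - 1) := by
        rw [ENNReal.rpow_sub _ _ h ht, ENNReal.rpow_one, ENNReal.div_eq_inv_mul]
    _ ≤ (K : ℝ≥0∞) ^ (p - 1) :=
        ENNReal.rpow_le_rpow (slowedLength_le h1 γ) (by linarith)

theorem memLp_slowedSpeed (hρ : Measurable ρ) {q : ℝ≥0∞} (hq0 : q ≠ 0) (hq : q ≠ ∞)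
    (h : ∫⁻ r, (slowedSpeed K hρ γ r : ℝ≥0∞) ^ q.toReal < ∞) :
    MemLp (fun r => (slowedSpeed K hρ γ r : ℝ)) q volume := by
  refine ⟨(measurable_slowedSpeed hρ).coe_nnreal_real.aestronglyMeasurable, ?_⟩
  rw [eLpNorm_lt_top_iff_lintegral_rpow_enorm_lt_top hq0 hq]
  simpa using h

theorem slowedLength_ne_zero (hρ : Measurable ρ) (hK : length γ ≤ K) (h0 : length γ ≠ 0) : slowedLength K ρ γ ≠ 0 := by
  have hm : Measurable fun t => (ρ (γ t) : ℝ≥0∞)⁻¹ :=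
    (hρ.comp γ.continuous.measurable).coe_nnreal_ennreal.inv
  intro h
  have h1 : ∀ᵐ t ∂lengthKernel X K γ, (ρ (γ t) : ℝ≥0∞)⁻¹ = 0 := (lintegral_eq_zero_iff hm).1 h
  have h2 : lengthKernel X K γ univ = 0 := by
    rw [ae_iff] at h1
    refine measure_mono_null (fun t _ => ?_) h1
    exact ENNReal.inv_ne_zero.2 ENNReal.coe_ne_top
  rw [lengthKernel_of_le hK, lengthMeasure_univ (hK.trans_lt ENNReal.coe_lt_top)] at h2
  exact h0 h2

variable [TopologicalSpace.SeparableSpace X]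

theorem slowedReparam_mem_acCurves (hρ : Measurable ρ) (h1 : ∀ x, 1 ≤ ρ x)
    (h : slowedLength K ρ γ ≠ 0) {q : ℝ≥0∞} (hq : 1 ≤ q)
    (hmem : MemLp (fun r => (slowedSpeed K hρ γ r : ℝ)) q volume) :
    slowedReparam K hρ γ ∈ acCurves X q ∧
    curveEnergy q (slowedReparam K hρ γ) ≤
      if q = ∞ then essSup (fun r => (slowedSpeed K hρ γ r : ℝ≥0∞)) volume
      else ∫⁻ r, (slowedSpeed K hρ γ r : ℝ≥0∞) ^ q.toReal := by
  have hd : ∀ s t : unitInterval, s < t → dist (slowedReparam K hρ γ s) (slowedReparam K hρ γ t) ≤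
      ∫ r in Icc s t, (slowedSpeed K hρ γ r : ℝ) := fun s t hst =>
    dist_le_setIntegral_of_edist_le (hmem.integrable hq) (edist_slowedReparam_le hρ h1 h hst.le)
  refine ⟨⟨_, fun r => NNReal.coe_nonneg _, hmem, hd⟩, ?_⟩
  have := curveEnergy_le hq (fun r => NNReal.coe_nonneg _) hmem hd
  simpa only [ENNReal.ofReal_coe_nnreal] using this

/-- At exponent `1` the bound involves `ρ ^ 0 = 1`, so no integrability of `ρ` along the curve is
needed and the reparametrization acts on all of `AC`. -/
theorem slowedReparam_mem_acCurves_one (hρ : Measurable ρ) (h1 : ∀ x, 1 ≤ ρ x)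
    (hγ : γ ∈ acCurves X 1) : slowedReparam K hρ γ ∈ acCurves X 1 := by
  by_cases h : slowedLength K ρ γ = 0
  · rwa [slowedReparam_of_slowedLength_eq_zero hρ h]
  · refine (slowedReparam_mem_acCurves hρ h1 h le_rfl
      (memLp_slowedSpeed hρ one_ne_zero ENNReal.one_ne_top ?_)).1
    rw [ENNReal.toReal_one]
    refine (lintegral_slowedSpeed_rpow_le hρ h1 h le_rfl).trans_lt ?_
    simp

theorem slowedReparam_mem_acCurves_of_ne_top (hρ : Measurable ρ) (h1 : ∀ x, 1 ≤ ρ x)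
    (h : slowedLength K ρ γ ≠ 0) {q : ℝ≥0∞} (hq : 1 ≤ q) (hq' : q ≠ ∞)
    (hfin : ∫⁻ t, (ρ (γ t) : ℝ≥0∞) ^ (q.toReal - 1) ∂lengthKernel X K γ < ∞) :
    slowedReparam K hρ γ ∈ acCurves X q ∧ curveEnergy q (slowedReparam K hρ γ) ≤
      (K : ℝ≥0∞) ^ (q.toReal - 1) *
        ∫⁻ t, (ρ (γ t) : ℝ≥0∞) ^ (q.toReal - 1) ∂lengthKernel X K γ := by
  have hp : 1 ≤ q.toReal := by
    rw [← ENNReal.toReal_one]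
    exact ENNReal.toReal_mono hq' hq
  have hle := lintegral_slowedSpeed_rpow_le hρ h1 h hp
  have hlt := hle.trans_lt (ENNReal.mul_lt_top
    (ENNReal.rpow_lt_top_of_nonneg (by linarith) ENNReal.coe_ne_top) hfin)
  have := slowedReparam_mem_acCurves hρ h1 h hq
    (memLp_slowedSpeed hρ (zero_lt_one.trans_le hq).ne' hq' hlt)
  rw [if_neg hq'] at this
  exact ⟨this.1, this.2.trans hle⟩

theorem slowedReparam_mem_acCurves_top (hρ : Measurable ρ) (h1 : ∀ x, 1 ≤ ρ x) {M : ℝ≥0}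
    (hM : ∀ x, ρ x ≤ M) (h : slowedLength K ρ γ ≠ 0) :
    slowedReparam K hρ γ ∈ acCurves X ∞ ∧ curveEnergy ∞ (slowedReparam K hρ γ) ≤ K * M := by
  have hle : ∀ r, slowedSpeed K hρ γ r ≤ K * M := fun r => by
    refine mul_le_mul' ?_ (hM _)
    exact ENNReal.toNNReal_mono ENNReal.coe_ne_top (slowedLength_le h1 γ)
  have hmem : MemLp (fun r => (slowedSpeed K hρ γ r : ℝ)) ∞ volume :=
    memLp_top_of_bound (measurable_slowedSpeed hρ).coe_nnreal_real.aestronglyMeasurable (K * M)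
      (Eventually.of_forall fun r => by
        rw [Real.norm_of_nonneg (NNReal.coe_nonneg _)]; exact_mod_cast hle r)
  have := slowedReparam_mem_acCurves hρ h1 h le_top hmem
  rw [if_pos rfl] at this
  refine ⟨this.1, this.2.trans (essSup_le_of_ae_le _ (Eventually.of_forall fun r => ?_))⟩
  rw [← ENNReal.coe_mul]
  exact ENNReal.coe_le_coe.2 (hle r)

theorem measurable_slowedLength (hρ : Measurable ρ) : Measurable (slowedLength K ρ) := by
  refine Measurable.lintegral_kernel_prod_right (κ := lengthKernel X K)
    (f := fun γ t => (ρ (γ t) : ℝ≥0∞)⁻¹) ?_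
  exact (hρ.comp measurable_eval).coe_nnreal_ennreal.inv

theorem measurable_timeMeasure_apply (hρ : Measurable ρ) {s : Set unitInterval}
    (hs : MeasurableSet s) : Measurable fun γ => timeMeasure K ρ γ s := by
  classical
  have h : (fun γ => timeMeasure K ρ γ s) = fun γ =>
      if slowedLength K ρ γ = 0 ∨ slowedLength K ρ γ = ∞ then volume s
      else (slowedLength K ρ γ)⁻¹ * ∫⁻ t in s, (ρ (γ t) : ℝ≥0∞)⁻¹ ∂lengthKernel X K γ := by
    ext γ
    unfold timeMeasure
    split_ifs
    · rfl
    · rw [Measure.smul_apply, withDensity_apply _ hs, smul_eq_mul]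
  rw [h]
  have hc : Measurable (slowedLength K ρ) := measurable_slowedLength hρ
  refine Measurable.ite ((hc (measurableSet_singleton 0)).union (hc (measurableSet_singleton ∞)))
    measurable_const (hc.inv.mul ?_)
  exact Measurable.setLIntegral_kernel_prod_right (κ := lengthKernel X K)
    (f := fun γ t => (ρ (γ t) : ℝ≥0∞)⁻¹)
    ((hρ.comp measurable_eval).coe_nnreal_ennreal.inv) hs

/-- Evaluation at `s` is `γ` at its quantile, jointly measurable in curve and time;
`quantile_le_iff` turns sublevel sets of the quantile into conditions on the time measure of `Iic
t`. -/
theorem measurable_slowedReparam (hρ : Measurable ρ) : Measurable (slowedReparam K hρ) := by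
  refine measurable_of_measurable_eval fun s => ?_
  have hT : Measurable fun γ : C(unitInterval, X) => quantile (timeMeasure K ρ γ) s := by
    refine measurable_of_Iic fun t => ?_
    have : (fun γ : C(unitInterval, X) => quantile (timeMeasure K ρ γ) s) ⁻¹' Iic t =
        {γ | ENNReal.ofReal s ≤ timeMeasure K ρ γ (Iic t)} := by
      ext γ
      rw [mem_preimage, mem_Iic, quantile_le_iff, mem_ofPred_eq, measure_Iic_eq_distFun,
        ENNReal.ofReal_le_ofReal_iff (distFun _ t).2.1, Subtype.coe_le_coe]
    rw [this]
    exact measurableSet_le measurable_const (measurable_timeMeasure_apply hρ measurableSet_Iic)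
  exact measurable_eval.comp (measurable_id.prodMk hT)

end SlowedReparam

/-! ### Analytic images, bounded densities and the majorant `ρ` -/

/-- The image of an analytic set under a measurable map is analytic. -/
theorem analyticSet_image_of_measurable {α β : Type*} [TopologicalSpace α] [MeasurableSpace α]
    [BorelSpace α] [TopologicalSpace β] [SecondCountableTopology β] [MeasurableSpace β]
    [OpensMeasurableSpace β] {f : α → β} (hf : Measurable f) {s : Set α} (hs : AnalyticSet s) :
    AnalyticSet (f '' s) := by
  rw [AnalyticSet] at hs
  rcases hs with rfl | ⟨g, hg, rfl⟩
  · rw [image_empty]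
    exact analyticSet_empty
  · rw [← range_comp, ← image_univ]
    borelize (ℕ → ℕ)
    exact MeasurableSet.univ.analyticSet_image (hf.comp hg.measurable)

theorem hasDensityIn_top_of_le_smul {X : Type*} [MeasurableSpace X] {μ m : Measure X}
    [SigmaFinite m] {c : ℝ≥0∞} (hc : c ≠ ∞) (h : μ ≤ c • m) : HasDensityIn μ m ∞ := by
  refine ⟨(Measure.absolutelyContinuous_of_le h).trans Measure.smul_absolutelyContinuous,
    (Measure.measurable_rnDeriv μ m).aestronglyMeasurable, ?_⟩
  have hle : μ.rnDeriv m ≤ᵐ[m] fun _ => c := by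
    refine ae_le_of_forall_setLIntegral_le_of_sigmaFinite (Measure.measurable_rnDeriv μ m)
      fun s hs _ => ?_
    rw [setLIntegral_const]
    exact (Measure.setLIntegral_rnDeriv_le s).trans (h s)
  rw [eLpNorm_exponent_top, eLpNormEssSup]
  exact (essSup_le_of_ae_le c hle).trans_lt hc.lt_top

/-- A finite measure with density in `L^q` is dominated by a finite function `ρ ≥ 1`, bounded if
`q = ∞`, and such that `ρ ^ (q - 1)` is integrable if `q < ∞`. -/
theorem HasDensityIn.exists_majorant {X : Type*} [MeasurableSpace X] {μ m : Measure X}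
    [SigmaFinite m] [IsFiniteMeasure μ] {q : ℝ≥0∞} (hq : 1 < q) (h : HasDensityIn μ m q) :
    ∃ ρ : X → ℝ≥0, Measurable ρ ∧ (∀ x, 1 ≤ ρ x) ∧ (∀ᵐ x ∂m, μ.rnDeriv m x ≤ ρ x) ∧
      (q = ∞ → ∃ M, ∀ x, ρ x ≤ M) ∧
      (q ≠ ∞ → ∫⁻ x, (ρ x : ℝ≥0∞) ^ (q.toReal - 1) ∂μ < ∞) := by
  have hb : Measurable (μ.rnDeriv m) := Measure.measurable_rnDeriv μ m
  by_cases hq' : q = ∞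
  · subst hq'
    have hfin : essSup (μ.rnDeriv m) m ≠ ∞ := by
      have := h.2.2
      rw [eLpNorm_exponent_top, eLpNormEssSup] at this
      exact this.ne
    refine ⟨fun _ => max 1 (essSup (μ.rnDeriv m) m).toNNReal, measurable_const,
      fun _ => le_max_left _ _, ?_, fun _ => ⟨_, fun _ => le_rfl⟩, fun h => absurd rfl h⟩
    filter_upwards [ENNReal.ae_le_essSup (μ.rnDeriv m)] with x hx
    refine hx.trans ?_
    rw [← ENNReal.coe_toNNReal hfin]
    exact ENNReal.coe_le_coe.2 (le_max_right _ _)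
  · have hp : 1 < q.toReal := by
      rw [← ENNReal.toReal_one]
      exact (ENNReal.toReal_lt_toReal ENNReal.one_ne_top hq').2 hq
    have hρ : Measurable fun x => max 1 (μ.rnDeriv m x).toNNReal :=
      measurable_const.max hb.ennreal_toNNReal
    refine ⟨fun x => max 1 (μ.rnDeriv m x).toNNReal, hρ, fun _ => le_max_left _ _, ?_,
      fun h => absurd h hq', fun _ => ?_⟩
    · filter_upwards [Measure.rnDeriv_lt_top μ m] with x hx
      rw [← ENNReal.coe_toNNReal hx.ne]
      exact ENNReal.coe_le_coe.2 (le_max_right _ _)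
    · have hF : Measurable fun x =>
          ((max 1 (μ.rnDeriv m x).toNNReal : ℝ≥0) : ℝ≥0∞) ^ (q.toReal - 1) :=
        hρ.coe_nnreal_ennreal.pow_const _
      have hint : ∫⁻ x, μ.rnDeriv m x ^ q.toReal ∂m < ∞ := by
        simpa using (eLpNorm_lt_top_iff_lintegral_rpow_enorm_lt_top (zero_lt_one.trans hq).ne'
          hq').1 h.2.2
      have hmass : ∫⁻ x, μ.rnDeriv m x ∂m < ∞ := Measure.lintegral_rnDeriv_lt_top μ m
      calc ∫⁻ x, ((max 1 (μ.rnDeriv m x).toNNReal : ℝ≥0) : ℝ≥0∞) ^ (q.toReal - 1) ∂μ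
          = ∫⁻ x, μ.rnDeriv m x *
              ((max 1 (μ.rnDeriv m x).toNNReal : ℝ≥0) : ℝ≥0∞) ^ (q.toReal - 1) ∂m := by
            exact (lintegral_rnDeriv_mul h.1 hF.aemeasurable).symm
        -- Pointwise, `b * max 1 b ^ (q - 1)` equals `b` where `b ≤ 1` and `b ^ q` where `b ≥ 1`.
        _ ≤ ∫⁻ x, (μ.rnDeriv m x + μ.rnDeriv m x ^ q.toReal) ∂m := by
            refine lintegral_mono_ae ?_
            filter_upwards [Measure.rnDeriv_lt_top μ m] with x hx
            rw [ENNReal.coe_max, ENNReal.coe_toNNReal hx.ne, ENNReal.coe_one]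
            rcases le_total (μ.rnDeriv m x) 1 with h1 | h1
            · rw [max_eq_left h1, ENNReal.one_rpow, mul_one]
              exact le_self_add
            · rw [max_eq_right h1]
              refine le_add_left (le_of_eq ?_)
              have h0 : μ.rnDeriv m x ≠ 0 := (zero_lt_one.trans_le h1).ne'
              rw [ENNReal.rpow_sub _ _ h0 hx.ne, ENNReal.rpow_one, ENNReal.mul_div_cancel h0 hx.ne]
        _ < ∞ := by
            rw [lintegral_add_left hb]
            exact ENNReal.add_lt_top.2 ⟨hmass, hint⟩

/-! ### The slowed plan: barycenter and energy -/

section Barycenter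

variable {X : Type*} [MetricSpace X] [CompleteSpace X] [TopologicalSpace.SeparableSpace X]
  [MeasurableSpace X] [BorelSpace X] {π : Measure C(unitInterval, X)} {K : ℝ≥0}

theorem measurable_map_lengthKernel :
    Measurable fun γ : C(unitInterval, X) => (lengthKernel X K γ).map γ := by
  refine Measure.measurable_of_measurable_coe _ fun s hs => ?_
  have h : ∀ γ : C(unitInterval, X), (lengthKernel X K γ).map γ s =
      ∫⁻ t, s.indicator 1 (γ t) ∂lengthKernel X K γ := fun γ => by
    rw [Measure.map_apply γ.continuous.measurable hs,
      ← lintegral_indicator_one (γ.continuous.measurable hs)]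
    rfl
  simp only [h]
  exact Measurable.lintegral_kernel_prod_right (κ := lengthKernel X K)
    (f := fun γ t => s.indicator (1 : X → ℝ≥0∞) (γ t))
    ((measurable_one.indicator hs).comp measurable_eval)

/-- The length bound permits replacing the length measures by the finite kernel `π`-almost
everywhere, which makes the integrand of `bind` a.e. measurable. -/
theorem lintegral_barycenterMeasure (hK : ∀ᵐ γ ∂π, length γ ≤ K) {F : X → ℝ≥0∞}
    (hF : Measurable F) : ∫⁻ x, F x ∂barycenterMeasure π =
      ∫⁻ γ, F (γ 0) ∂π + ∫⁻ γ, F (γ 1) ∂π + ∫⁻ γ, ∫⁻ t, F (γ t) ∂lengthKernel X K γ ∂π := by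
  have hae : (fun γ : C(unitInterval, X) => (lengthKernel X K γ).map γ) =ᵐ[π]
      fun γ => (lengthMeasure γ).map γ := by
    filter_upwards [hK] with γ hγ
    rw [lengthKernel_of_le hγ]
  have hm : AEMeasurable (fun γ : C(unitInterval, X) => (lengthMeasure γ).map γ) π :=
    ⟨_, measurable_map_lengthKernel, hae.symm⟩
  rw [barycenterMeasure, lintegral_add_measure, lintegral_add_measure,
    lintegral_map hF (measurable_eval_const 0), lintegral_map hF (measurable_eval_const 1),
    Measure.lintegral_bind hm hF.aemeasurable]
  congr 1
  refine lintegral_congr_ae ?_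
  filter_upwards [hae] with γ hγ
  rw [← hγ, lintegral_map hF γ.continuous.measurable]

theorem isFiniteMeasure_barycenterMeasure [IsProbabilityMeasure π]
    (hK : ∀ᵐ γ ∂π, length γ ≤ K) : IsFiniteMeasure (barycenterMeasure π) where
  measure_univ_lt_top := by
    rw [← lintegral_one, lintegral_barycenterMeasure hK measurable_const]
    simp only [lintegral_one, measure_univ]
    refine ENNReal.add_lt_top.2 ⟨by simp, ?_⟩
    refine (lintegral_mono fun γ => lengthKernel_univ_le K γ).trans_lt ?_
    simp

variable {ρ : X → ℝ≥0}

theorem measurable_slowedWeight (hρ : Measurable ρ) : Measurable (slowedWeight K ρ) :=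
  (measurable_slowedLength hρ).min
    ((hρ.comp (measurable_eval_const 0)).coe_nnreal_ennreal.inv.min
      (hρ.comp (measurable_eval_const 1)).coe_nnreal_ennreal.inv)

/-- The weighted push-forward of a plan under the reparametrization with speed proportional to
`ρ`, normalized to a probability measure. -/
def slowedPlan (K : ℝ≥0) {ρ : X → ℝ≥0} (hρ : Measurable ρ) (π : Measure C(unitInterval, X)) :
    Measure C(unitInterval, X) :=
  (slowedMass K ρ π)⁻¹ • (π.withDensity (slowedWeight K ρ)).map (slowedReparam K hρ)

theorem slowedMass_ne_zero [NeZero π] (hρ : Measurable ρ)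
    (h : ∀ᵐ γ ∂π, slowedLength K ρ γ ≠ 0) : slowedMass K ρ π ≠ 0 := by
  intro h0
  have h1 : ∀ᵐ γ ∂π, slowedWeight K ρ γ = 0 :=
    (lintegral_eq_zero_iff (measurable_slowedWeight hρ)).1 h0
  have h2 : ∀ᵐ γ ∂π, False := by
    filter_upwards [h, h1] with γ h2 h3 using slowedWeight_ne_zero h2 h3
  simp only [eventually_false_iff_eq_bot, ae_eq_bot] at h2
  exact NeZero.ne π h2

theorem isProbabilityMeasure_slowedPlan (hρ : Measurable ρ) (h0 : slowedMass K ρ π ≠ 0)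
    (ht : slowedMass K ρ π ≠ ∞) : IsProbabilityMeasure (slowedPlan K hρ π) where
  measure_univ := by
    rw [slowedPlan, Measure.smul_apply, Measure.map_apply (measurable_slowedReparam hρ) .univ,
      preimage_univ, withDensity_apply _ .univ, Measure.restrict_univ]
    exact ENNReal.inv_mul_cancel h0 ht

theorem slowedPlan_absolutelyContinuous (hρ : Measurable ρ) :
    slowedPlan K hρ π ≪ π.map (slowedReparam K hρ) :=
  Measure.smul_absolutelyContinuous.trans
    ((withDensity_absolutelyContinuous _ _).map (measurable_slowedReparam hρ))

theorem concentratedOn_slowedPlan [IsFiniteMeasure π] (hρ : Measurable ρ)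
    {E : Set C(unitInterval, X)} (hE : π Eᶜ = 0) {E' : Set C(unitInterval, X)}
    (h : slowedReparam K hρ '' E ⊆ E') : ConcentratedOn (slowedPlan K hρ π) E' := by
  have := UniformSpace.secondCountable_of_separable X
  exact slowedPlan_absolutelyContinuous hρ (measure_mono_null (compl_subset_compl.2 h)
    (map_compl_image_eq_zero (measurable_slowedReparam hρ) hE))

theorem lintegral_slowedPlan (hρ : Measurable ρ) {f : C(unitInterval, X) → ℝ≥0∞}
    (hf : Measurable f) : ∫⁻ η, f η ∂slowedPlan K hρ π =
      (slowedMass K ρ π)⁻¹ * ∫⁻ γ, slowedWeight K ρ γ * f (slowedReparam K hρ γ) ∂π := by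
  have hfm : Measurable fun γ => f (slowedReparam K hρ γ) := hf.comp (measurable_slowedReparam hρ)
  rw [slowedPlan, lintegral_smul_measure, lintegral_map hf (measurable_slowedReparam hρ),
    lintegral_withDensity_eq_lintegral_mul _ (measurable_slowedWeight hρ) hfm, smul_eq_mul]
  rfl

/-- The weight is at most `1`. Only an upper bound is claimed, so `f` need not be measurable; this
is how it applies to the energy. -/
theorem lintegral_slowedPlan_le (hρ : Measurable ρ) (h1 : ∀ x, 1 ≤ ρ x)
    {f Φ : C(unitInterval, X) → ℝ≥0∞} (h : ∀ᵐ γ ∂π, f (slowedReparam K hρ γ) ≤ Φ γ) :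
    ∫⁻ η, f η ∂slowedPlan K hρ π ≤ (slowedMass K ρ π)⁻¹ * ∫⁻ γ, Φ γ ∂π := by
  rw [slowedPlan, lintegral_smul_measure, smul_eq_mul]
  refine mul_le_mul_right ((lintegral_map_le f (slowedReparam K hρ)).trans ?_) _
  have hle : π.withDensity (slowedWeight K ρ) ≤ π := by
    conv_rhs => rw [← withDensity_one (μ := π)]
    exact withDensity_mono (Eventually.of_forall (slowedWeight_le_one h1))
  exact (lintegral_mono' hle le_rfl).trans (lintegral_mono_ae h)

/-- Each of the three terms on a set `A` is bounded by the matching term of the original barycenter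
tested against `1_A/ρ`. -/
theorem parametricBarycenterMeasure_slowedPlan_le [IsProbabilityMeasure π] {m : Measure X}
    [SigmaFinite m] (hρ : Measurable ρ) (h1 : ∀ x, 1 ≤ ρ x) (hK : ∀ᵐ γ ∂π, length γ ≤ K)
    (hac : barycenterMeasure π ≪ m) (hle : ∀ᵐ x ∂m, (barycenterMeasure π).rnDeriv m x ≤ ρ x) :
    parametricBarycenterMeasure (slowedPlan K hρ π) ≤ (slowedMass K ρ π)⁻¹ • m := by
  have := isFiniteMeasure_barycenterMeasure hK
  refine Measure.le_iff.2 fun A hA => ?_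
  let F : X → ℝ≥0∞ := A.indicator fun x => (ρ x : ℝ≥0∞)⁻¹
  have hF : Measurable F := hρ.coe_nnreal_ennreal.inv.indicator hA
  have hA1 : Measurable (A.indicator (1 : X → ℝ≥0∞)) := measurable_one.indicator hA
  have hFA : ∀ x, (ρ x : ℝ≥0∞)⁻¹ * A.indicator 1 x = F x := fun x => by
    by_cases hx : x ∈ A <;> simp [F, hx]
  -- Here `b ≤ ρ` enters: `∫_A b/ρ dm ≤ m A`.
  have hbar : ∫⁻ x, F x ∂barycenterMeasure π ≤ m A := by
    rw [← lintegral_rnDeriv_mul hac hF.aemeasurable, ← lintegral_indicator_one hA]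
    refine lintegral_mono_ae ?_
    filter_upwards [hle] with x hx
    by_cases hxA : x ∈ A
    · simp only [F, indicator_of_mem hxA, Pi.one_apply]
      refine (mul_le_mul_left hx _).trans (ENNReal.mul_inv_le_one _)
    · simp [F, hxA]
  have hpt : ∀ t, ∀ γ : C(unitInterval, X), slowedReparam K hρ γ t = γ t →
      slowedWeight K ρ γ ≤ (ρ (γ t) : ℝ≥0∞)⁻¹ →
      slowedWeight K ρ γ * A.indicator 1 (slowedReparam K hρ γ t) ≤ F (γ t) := by
    intro t γ ht hw
    rw [ht, ← hFA]
    exact mul_le_mul_left hw _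
  have hend : ∀ t : unitInterval, (slowedPlan K hρ π).map (fun γ => γ t) A = (slowedMass K ρ π)⁻¹ *
      ∫⁻ γ, slowedWeight K ρ γ * A.indicator 1 (slowedReparam K hρ γ t) ∂π := fun t => by
    have hAt : Measurable fun γ : C(unitInterval, X) => A.indicator (1 : X → ℝ≥0∞) (γ t) :=
      hA1.comp (measurable_eval_const t)
    rw [← lintegral_indicator_one hA, lintegral_map hA1 (measurable_eval_const t),
      lintegral_slowedPlan hρ hAt]
  have hprod : ((slowedPlan K hρ π).prod volume).map (fun p => p.1 p.2) A =
      (slowedMass K ρ π)⁻¹ * ∫⁻ γ, slowedWeight K ρ γ *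
        (∫⁻ r : unitInterval, A.indicator 1 (slowedReparam K hρ γ r)) ∂π := by
    have hm : Measurable fun p : C(unitInterval, X) × unitInterval =>
        A.indicator (1 : X → ℝ≥0∞) (p.1 p.2) := hA1.comp measurable_eval
    rw [← lintegral_indicator_one hA, lintegral_map hA1 measurable_eval,
      lintegral_prod _ hm.aemeasurable, lintegral_slowedPlan hρ hm.lintegral_prod_right']
  rw [parametricBarycenterMeasure, Measure.add_apply, Measure.add_apply, hend, hend, hprod,
    ← mul_add, ← mul_add, Measure.smul_apply, smul_eq_mul]
  gcongr
  refine le_trans ?_ hbar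
  rw [lintegral_barycenterMeasure hK hF]
  refine add_le_add (add_le_add (lintegral_mono fun γ => ?_) (lintegral_mono fun γ => ?_))
    (lintegral_mono fun γ => ?_)
  · exact hpt 0 γ (slowedReparam_zero hρ γ) ((min_le_right _ _).trans (min_le_left _ _))
  · exact hpt 1 γ (slowedReparam_one hρ γ) ((min_le_right _ _).trans (min_le_right _ _))
  · by_cases h0 : slowedLength K ρ γ = 0
    · simp [slowedWeight, h0]
    have ht : slowedLength K ρ γ ≠ ∞ := ((slowedLength_le h1 γ).trans_lt ENNReal.coe_lt_top).ne
    rw [lintegral_slowedReparam hρ h1 h0 hA1]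
    simp only [hFA]
    refine (mul_le_mul_left (min_le_left _ _) _).trans_eq ?_
    rw [← mul_assoc, ENNReal.mul_inv_cancel h0 ht, one_mul]

end Barycenter

/-- For finite `q`, the `π`-average of the energy bound is, up to a constant, the length part of `∫
ρ^(q-1)` against the barycenter; for `q = ∞` the energies are uniformly bounded. -/
theorem hasFiniteEnergy_slowedPlan {X : Type*} [MetricSpace X] [CompleteSpace X]
    [TopologicalSpace.SeparableSpace X] [MeasurableSpace X] [BorelSpace X]
    {π : Measure C(unitInterval, X)} [IsProbabilityMeasure π] {K : ℝ≥0} {ρ : X → ℝ≥0}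
    (hρ : Measurable ρ) (h1 : ∀ x, 1 ≤ ρ x) (hK : ∀ᵐ γ ∂π, length γ ≤ K)
    (h0 : ∀ᵐ γ ∂π, slowedLength K ρ γ ≠ 0) {q : ℝ≥0∞} (hq : 1 < q)
    (htop : q = ∞ → ∃ M, ∀ x, ρ x ≤ M)
    (hfin : q ≠ ∞ → ∫⁻ x, (ρ x : ℝ≥0∞) ^ (q.toReal - 1) ∂barycenterMeasure π < ∞) :
    HasFiniteEnergy q (slowedPlan K hρ π) := by
  have hZ := slowedMass_ne_zero hρ h0
  suffices ∃ Φ : C(unitInterval, X) → ℝ≥0∞, ∫⁻ γ, Φ γ ∂π < ∞ ∧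
      ∀ᵐ γ ∂π, slowedReparam K hρ γ ∈ acCurves X q ∧
        curveEnergy q (slowedReparam K hρ γ) ≤ Φ γ by
    obtain ⟨Φ, hΦ, hae⟩ := this
    refine ⟨concentratedOn_slowedPlan hρ (E := {γ | slowedReparam K hρ γ ∈ acCurves X q})
      (hae.mono fun γ hγ => hγ.1) (image_subset_iff.2 fun γ hγ => hγ), ?_⟩
    exact (lintegral_slowedPlan_le hρ h1 (hae.mono fun γ hγ => hγ.2)).trans_lt
      (ENNReal.mul_lt_top (ENNReal.inv_lt_top.2 (pos_iff_ne_zero.2 hZ)) hΦ)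
  by_cases hq' : q = ∞
  · subst hq'
    obtain ⟨M, hM⟩ := htop rfl
    refine ⟨fun _ => K * M, ?_, h0.mono fun γ hγ => slowedReparam_mem_acCurves_top hρ h1 hM hγ⟩
    simpa using ENNReal.mul_lt_top ENNReal.coe_lt_top ENNReal.coe_lt_top
  · have hF : Measurable fun x => (ρ x : ℝ≥0∞) ^ (q.toReal - 1) :=
      hρ.coe_nnreal_ennreal.pow_const _
    have hm : Measurable fun γ => ∫⁻ t, (ρ (γ t) : ℝ≥0∞) ^ (q.toReal - 1) ∂lengthKernel X K γ :=
      Measurable.lintegral_kernel_prod_right (κ := lengthKernel X K)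
        (f := fun γ t => (ρ (γ t) : ℝ≥0∞) ^ (q.toReal - 1)) (hF.comp measurable_eval)
    have hint : ∫⁻ γ, ∫⁻ t, (ρ (γ t) : ℝ≥0∞) ^ (q.toReal - 1) ∂lengthKernel X K γ ∂π < ∞ := by
      refine lt_of_le_of_lt ?_ (hfin hq')
      rw [lintegral_barycenterMeasure hK hF]
      exact le_add_self
    refine ⟨fun γ => (K : ℝ≥0∞) ^ (q.toReal - 1) *
      ∫⁻ t, (ρ (γ t) : ℝ≥0∞) ^ (q.toReal - 1) ∂lengthKernel X K γ, ?_, ?_⟩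
    · rw [lintegral_const_mul _ hm]
      refine ENNReal.mul_lt_top (ENNReal.rpow_lt_top_of_nonneg ?_ ENNReal.coe_ne_top) hint
      rw [sub_nonneg, ← ENNReal.toReal_one]
      exact ENNReal.toReal_mono hq' hq.le
    · filter_upwards [h0, ae_lt_top hm hint.ne] with γ h2 h3
      exact slowedReparam_mem_acCurves_of_ne_top hρ h1 h2 hq.le hq' h3

end CurvePlan

end

/-! ### The main theorem -/

theorem mainTheorem7 {X : Type*} [MetricSpace X] [CompleteSpace X]
    [TopologicalSpace.SeparableSpace X] [MeasurableSpace X] [BorelSpace X]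
    (m : Measure X)
    (hm : ∀ B : Set X, MeasurableSet B → Bornology.IsBounded B → m B < ∞)
    (q : ℝ≥0∞) (hq : 1 < q)
    (π : Measure C(unitInterval, X)) (hπ_prob : IsProbabilityMeasure π)
    (hπ_plan : CurvePlan.IsPlan π) (hπ_bar : CurvePlan.HasBarycenterIn π m q)
    (Γ : Set C(unitInterval, X)) (hΓ : AnalyticSet Γ)
    (hΓ_lip : Γ ⊆ CurvePlan.lipschitzCurves X)
    (hΓ_conc : CurvePlan.ConcentratedOn π Γ)
    (ha : ∃ C : ℝ≥0, 0 < C ∧ ∀ᵐ γ ∂π, γ ∈ Γ → LipschitzWith C γ)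
    (hb : ∃ l : ℝ≥0, 0 < l ∧ ∀ᵐ γ ∂π, γ ∈ Γ → (l : ℝ≥0∞) ≤ CurvePlan.length γ)
    (hc : ∃ B : Set X, MeasurableSet B ∧ Bornology.IsBounded B ∧
      ∀ᵐ γ ∂π, γ ∈ Γ → range γ ⊆ B) :
    ∃ (H : CurvePlan.acCurves X 1 → CurvePlan.acCurves X 1)
      (σ : Measure C(unitInterval, X)),
      Measurable H ∧
      (∀ γ : CurvePlan.acCurves X 1, CurvePlan.IsReparametrization γ.1 (H γ).1) ∧
      IsProbabilityMeasure σ ∧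
      CurvePlan.IsPlan σ ∧
      CurvePlan.HasParametricBarycenterIn σ m ∞ ∧
      CurvePlan.HasFiniteEnergy q σ ∧
      AnalyticSet {η : C(unitInterval, X) |
        ∃ γ : CurvePlan.acCurves X 1, γ.1 ∈ Γ ∧ (H γ).1 = η} ∧
      CurvePlan.ConcentratedOn σ {η : C(unitInterval, X) |
        ∃ γ : CurvePlan.acCurves X 1, γ.1 ∈ Γ ∧ (H γ).1 = η} := by
  open CurvePlan in
  have := UniformSpace.secondCountable_of_separable X
  -- With second countability this makes `m` σ-finite, as the density arguments require.
  have : IsLocallyFiniteMeasure m :=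
    ⟨fun x => ⟨Metric.ball x 1, Metric.ball_mem_nhds x one_pos,
      hm _ Metric.isOpen_ball.measurableSet Metric.isBounded_ball⟩⟩
  obtain ⟨K, -, hK⟩ := ha
  obtain ⟨l, hl, hlen⟩ := hb
  have hΓ_ae : ∀ᵐ γ ∂π, γ ∈ Γ := hΓ_conc
  have hK' : ∀ᵐ γ ∂π, length γ ≤ K := by
    filter_upwards [hΓ_ae, hK] with γ h1 h2 using length_le_of_lipschitzWith (h2 h1)
  have := isFiniteMeasure_barycenterMeasure hK'
  obtain ⟨ρ, hρ, hρ1, hle, htop, hfin⟩ := hπ_bar.exists_majorant hq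
  have h0 : ∀ᵐ γ ∂π, slowedLength K ρ γ ≠ 0 := by
    filter_upwards [hΓ_ae, hK', hlen] with γ h1 h2 h3
    exact slowedLength_ne_zero hρ h2 ((ENNReal.coe_pos.2 hl).trans_le (h3 h1)).ne'
  have hΓ_ac : Γ ⊆ acCurves X 1 := hΓ_lip.trans (lipschitzCurves_subset_acCurves 1)
  have hZ := slowedMass_ne_zero hρ h0
  have hprob := isProbabilityMeasure_slowedPlan hρ hZ (slowedMass_ne_top (K := K) hρ1)
  have himage : {η : C(unitInterval, X) | ∃ γ : acCurves X 1, γ.1 ∈ Γ ∧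
      slowedReparam K hρ γ.1 = η} = slowedReparam K hρ '' Γ := by
    ext η
    exact ⟨fun ⟨γ, h1, h2⟩ => ⟨γ.1, h1, h2⟩, fun ⟨γ, h1, h2⟩ => ⟨⟨γ, hΓ_ac h1⟩, h1, h2⟩⟩
  refine ⟨fun γ => ⟨slowedReparam K hρ γ.1, slowedReparam_mem_acCurves_one hρ hρ1 γ.2⟩,
    slowedPlan K hρ π, ((measurable_slowedReparam hρ).comp measurable_subtype_coe).subtype_mk,
    fun γ => isReparametrization_slowedReparam hρ γ.1, hprob, ⟨inferInstance, ?_⟩,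
    hasDensityIn_top_of_le_smul (ENNReal.inv_ne_top.2 hZ)
      (parametricBarycenterMeasure_slowedPlan_le hρ hρ1 hK' hπ_bar.1 hle),
    hasFiniteEnergy_slowedPlan hρ hρ1 hK' h0 hq htop hfin, ?_, ?_⟩
  · refine concentratedOn_slowedPlan hρ hΓ_conc (image_subset_iff.2 fun γ hγ => ?_)
    exact acCurves_one_subset_rectifiableCurves (slowedReparam_mem_acCurves_one hρ hρ1 (hΓ_ac hγ))
  · exact himage ▸ analyticSet_image_of_measurable (measurable_slowedReparam hρ) hΓ
  · exact himage ▸ concentratedOn_slowedPlan hρ hΓ_conc subset_rfl
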